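/- **Setting.** A transition system $\mathcal T=(V,E,v_I,\lambda)$ over a set $\mathrm{AP}$ of atomic propositions consists of a set $V$ of vertices, edges $E\subseteq V\times V$, an initial vertex $v_I\in V$ and a labelling $\lambda:V\to 2^{\mathrm{AP}}$; it is *total* if every vertex has a successor. A path is an infinite sequence of vertices along edges. HyperCTL\* formulas are given by $$\varphi ::= a_\pi\mid\neg\varphi\mid\varphi\vee\varphi\mid \mathbf X\varphi\mid\varphi\,\mathbf U\,\varphi\mid\exists\pi.\,\varphi\mid\forall\pi.\,\varphi ,$$ with $a\in\mathrm{AP}$ and $\pi$ a path variable. A HyperCTL\* sentence has no free variable, and each of its temporal operators lies in the scope of a quantifier. Formulas are evaluated under a partial assignment $\Pi$ of paths to variables. The formula $a_\pi$ holds if $a$ labels the first vertex of $\Pi(\pi)$; temporal operators replace all assigned paths by suffixes synchronously; and $\exists\pi,\forall\pi$ range over the paths that start in the first vertex of the most recently assigned path (in $v_I$ if no path is assigned). $\mathcal T$ is a model of a sentence $\varphi$ if $\varphi$ holds in $\mathcal T$ under the empty assignment, and $\varphi$ is satisfiable if it has a model. In the satisfiability problem the propositions of the formulas are drawn from a fixed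 countably infinite set. A HyperLTL sentence is a closed formula of the form $Q_1\pi_1\dots Q_k\pi_k.\,\psi$ with $Q_i\in\{\exists,\forall\}$ and $\psi$ quantifier-free. It is evaluated over a set $S$ of traces $t:\mathbb N\to 2^{\mathrm{AP}}$, and the quantifiers range over $S$. A formula of existential third-order arithmetic has the form $\exists X_1\cdots\exists X_n.\,\psi$, where the $X_i$ range over sets of sets of natural numbers and $\psi$ is a formula over $(\mathbb N,0,1,+,\cdot,<,\in)$ that may mention the $X_i$ and quantifies over natural numbers and sets of natural numbers only. A set $N\subseteq\mathbb N$ is $\Sigma^2_1$ if it is defined by such a formula whose only free variable is one number variable. Computability of functions on formulas refers to a standard Gödel numbering. **Proposition.** 1. HyperCTL\* satisfiability is $\Sigma^2_1$-hard: for every $\Sigma^2_1$ set $N\subseteq\mathbb N$ there is a computable function $f$ from $\mathbb N$ to HyperCTL\* sentences such that, for all $n$, $n\in N$ if and only if $f(n)$ is satisfiable. 2. There is a computable function that maps every sentence $\Phi$ of existential third-order arithmetic to a HyperCTL\* sentence $\Phi'$ such that $\Phi$ is true if and only if $\Phi'$ is satisfiable. 3. There is a HyperCTL\* sentence $\varphi_{\mathit{set}}$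 over $\{\mathtt{fbt},\mathtt{set},0,1\}$ that is satisfiable, even by a total transition system, and such that every model $(V,E,v_I,\lambda)$ of it has paths $\rho_A$, one for each $A\subseteq\mathbb N$, for which: $\rho_A(0)$ is a successor of $v_I$; for every $i$, $\mathtt{set}\in\lambda(\rho_A(i))$, $1\in\lambda(\rho_A(i))$ iff $i\in A$, and $0\in\lambda(\rho_A(i))$ iff $i\notin A$; and $\rho_A(0)\neq\rho_B(0)$ whenever $A\ne B$. In particular every model has at least $2^{\aleph_0}$ vertices. 4. There is a HyperLTL sentence $\varphi_{\mathit{op}}$ over $\{\mathtt{arg1},\mathtt{arg2},\mathtt{res},\mathtt{add},\mathtt{mult}\}$ whose unique model is the set of all traces $t$ such that $\mathtt{arg1},\mathtt{arg2},\mathtt{res}$ hold at exactly one position each, say at $n_1,n_2,n_3$, and either $\mathtt{add}$ holds at every position, $\mathtt{mult}$ at none and $n_1+n_2=n_3$, or $\mathtt{mult}$ holds at every position, $\mathtt{add}$ at none and $n_1\cdot n_2=n_3$. Parts 1 and 2 hold both when satisfiability refers to arbitrary transition systems and when it refers to total ones only. -/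

import Mathlib

universe u

/-! ## Formulas, transition systems and satisfaction for HyperCTL* and HyperLTL -/

/-- Formulas over the atomic propositions `AP`; path (trace) variables are natural numbers.
`atom a p` is the formula "`a` holds now on `p`". -/
inductive HyperFormula (AP : Type) : Type
  | atom (a : AP) (p : ℕ)
  | neg (φ : HyperFormula AP)
  | or (φ ψ : HyperFormula AP)
  | next (φ : HyperFormula AP)
  | untl (φ ψ : HyperFormula AP)
  | ex (p : ℕ) (φ : HyperFormula AP)
  | all (p : ℕ) (φ : HyperFormula AP)

namespace HyperFormula

variable {AP : Type}

/-- The variables that occur free. -/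
def freeVars : HyperFormula AP → Set ℕ
  | atom _ p => {p}
  | neg φ => freeVars φ
  | or φ ψ => freeVars φ ∪ freeVars ψ
  | next φ => freeVars φ
  | untl φ ψ => freeVars φ ∪ freeVars ψ
  | ex p φ => freeVars φ \ {p}
  | all p φ => freeVars φ \ {p}

/-- Every temporal operator occurs in the scope of a quantifier. -/
def TemporalInScope : HyperFormula AP → Prop
  | atom _ _ => True
  | neg φ => TemporalInScope φ
  | or φ ψ => TemporalInScope φ ∧ TemporalInScope ψ
  | next _ => False
  | untl _ _ => False
  | ex _ _ => True
  | all _ _ => True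

/-- HyperCTL* sentences. -/
def IsCTLSentence (φ : HyperFormula AP) : Prop :=
  φ.TemporalInScope ∧ φ.freeVars = ∅

/-- No quantifier occurs. -/
def QuantifierFree : HyperFormula AP → Prop
  | atom _ _ => True
  | neg φ => QuantifierFree φ
  | or φ ψ => QuantifierFree φ ∧ QuantifierFree ψ
  | next φ => QuantifierFree φ
  | untl φ ψ => QuantifierFree φ ∧ QuantifierFree ψ
  | ex _ _ => False
  | all _ _ => False

/-- A block of quantifiers followed by a quantifier-free formula: the syntax of HyperLTL. -/
inductive Prenex : HyperFormula AP → Prop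
  | body (φ : HyperFormula AP) : QuantifierFree φ → Prenex φ
  | ex (p : ℕ) (φ : HyperFormula AP) : Prenex φ → Prenex (HyperFormula.ex p φ)
  | all (p : ℕ) (φ : HyperFormula AP) : Prenex φ → Prenex (HyperFormula.all p φ)

/-- HyperLTL sentences. -/
def IsLTLSentence (φ : HyperFormula AP) : Prop :=
  φ.Prenex ∧ φ.freeVars = ∅

end HyperFormula

/-- A transition system with vertex set `V`: edges, an initial vertex, a labelling. -/
structure TransitionSystem (AP : Type) (V : Type u) where
  edge : V → V → Prop
  init : V
  label : V → Set AP

namespace TransitionSystem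

variable {AP : Type} {V : Type u}

/-- Every vertex has at least one outgoing edge. -/
def IsTotal (T : TransitionSystem AP V) : Prop :=
  ∀ v, ∃ w, T.edge v w

/-- Paths are infinite sequences of vertices along edges. -/
def IsPath (T : TransitionSystem AP V) (r : ℕ → V) : Prop :=
  ∀ n, T.edge (r n) (r (n + 1))

end TransitionSystem

/-- A partial assignment of paths to variables, together with the variable that was
assigned most recently (`none` for the empty assignment). -/
structure PathAssignment (V : Type u) where
  path : ℕ → Option (ℕ → V)
  last : Option ℕ

namespace PathAssignment

variable {V : Type u}

/-- The assignment with empty domain. -/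
def empty : PathAssignment V := ⟨fun _ => none, none⟩

/-- Map the variable `p` to the path `r`; `p` becomes the most recent variable. -/
def assign (P : PathAssignment V) (p : ℕ) (r : ℕ → V) : PathAssignment V :=
  ⟨Function.update P.path p (some r), some p⟩

/-- Replace every assigned path by its suffix from position `j` onwards. -/
def suffix (P : PathAssignment V) (j : ℕ) : PathAssignment V :=
  ⟨fun p => (P.path p).map (fun r n => r (n + j)), P.last⟩

/-- The first vertex of the most recently assigned path, and `v₀` if there is none. -/
def recent (P : PathAssignment V) (v₀ : V) : V :=
  (P.last.bind P.path).elim v₀ (fun r => r 0)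

end PathAssignment

namespace HyperFormula

variable {AP : Type} {V : Type u}

/-- HyperCTL* semantics: quantifiers range over the paths that start in the first vertex of
the most recently assigned path. -/
def CTLSat (T : TransitionSystem AP V) : HyperFormula AP → PathAssignment V → Prop
  | atom a p, P => ∃ r, P.path p = some r ∧ a ∈ T.label (r 0)
  | neg φ, P => ¬ CTLSat T φ P
  | or φ ψ, P => CTLSat T φ P ∨ CTLSat T ψ P
  | next φ, P => CTLSat T φ (P.suffix 1)
  | untl φ ψ, P =>
      ∃ j, CTLSat T ψ (P.suffix j) ∧ ∀ i < j, CTLSat T φ (P.suffix i)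
  | ex p φ, P =>
      ∃ r, T.IsPath r ∧ r 0 = P.recent T.init ∧ CTLSat T φ (P.assign p r)
  | all p φ, P =>
      ∀ r, T.IsPath r → r 0 = P.recent T.init → CTLSat T φ (P.assign p r)

/-- `T` is a model of the HyperCTL* sentence `φ`. -/
def CTLModel (T : TransitionSystem AP V) (φ : HyperFormula AP) : Prop :=
  CTLSat T φ PathAssignment.empty

/-- Some transition system is a model. -/
def CTLSatisfiable (φ : HyperFormula AP) : Prop :=
  ∃ (V : Type u) (T : TransitionSystem AP V), CTLModel T φ

/-- Some transition system without dead ends is a model. -/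
def CTLSatisfiableTotal (φ : HyperFormula AP) : Prop :=
  ∃ (V : Type u) (T : TransitionSystem AP V), T.IsTotal ∧ CTLModel T φ

/-- HyperLTL semantics on a set `S` of traces. -/
def LTLSat (S : Set (ℕ → Set AP)) : HyperFormula AP → (ℕ → Option (ℕ → Set AP)) → Prop
  | atom a p, P => ∃ t, P p = some t ∧ a ∈ t 0
  | neg φ, P => ¬ LTLSat S φ P
  | or φ ψ, P => LTLSat S φ P ∨ LTLSat S ψ P
  | next φ, P => LTLSat S φ (fun p => (P p).map (fun t n => t (n + 1)))
  | untl φ ψ, P =>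
      ∃ j, LTLSat S ψ (fun p => (P p).map (fun t n => t (n + j))) ∧
        ∀ i < j, LTLSat S φ (fun p => (P p).map (fun t n => t (n + i)))
  | ex p φ, P => ∃ t ∈ S, LTLSat S φ (Function.update P p (some t))
  | all p φ, P => ∀ t ∈ S, LTLSat S φ (Function.update P p (some t))

/-- The set of traces `S` is a model of the HyperLTL sentence `φ`. -/
def LTLModel (S : Set (ℕ → Set AP)) (φ : HyperFormula AP) : Prop :=
  LTLSat S φ (fun _ => none)

/-- Gödel number of a formula whose atomic propositions are natural numbers. -/
def code : HyperFormula ℕ → ℕ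
  | atom a p => 7 * Nat.pair a p
  | neg φ => 7 * code φ + 1
  | or φ ψ => 7 * Nat.pair (code φ) (code ψ) + 2
  | next φ => 7 * code φ + 3
  | untl φ ψ => 7 * Nat.pair (code φ) (code ψ) + 4
  | ex p φ => 7 * Nat.pair p (code φ) + 5
  | all p φ => 7 * Nat.pair p (code φ) + 6

theorem code_injective : Function.Injective code := by
  intro φ
  induction φ with
  | atom a p =>
    intro χ h
    cases χ <;> simp only [code] at h <;> try omega
    simp [Nat.pair_eq_pair] at h
    rw [h.1, h.2]
  | neg φ ih =>
    intro χ h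
    cases χ <;> simp only [code] at h <;> try omega
    simp at h
    rw [ih h]
  | next φ ih =>
    intro χ h
    cases χ <;> simp only [code] at h <;> try omega
    simp at h
    rw [ih h]
  | or φ ψ ih₁ ih₂ =>
    intro χ h
    cases χ <;> simp only [code] at h <;> try omega
    simp [Nat.pair_eq_pair] at h
    rw [ih₁ h.1, ih₂ h.2]
  | untl φ ψ ih₁ ih₂ =>
    intro χ h
    cases χ <;> simp only [code] at h <;> try omega
    simp [Nat.pair_eq_pair] at h
    rw [ih₁ h.1, ih₂ h.2]
  | ex p φ ih =>
    intro χ h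
    cases χ <;> simp only [code] at h <;> try omega
    simp [Nat.pair_eq_pair] at h
    rw [h.1, ih h.2]
  | all p φ ih =>
    intro χ h
    cases χ <;> simp only [code] at h <;> try omega
    simp [Nat.pair_eq_pair] at h
    rw [h.1, ih h.2]

theorem code_surjective : Function.Surjective code := by
  intro n
  induction n using Nat.strong_induction_on with
  | _ n ih =>
    have hn := Nat.div_add_mod n 7
    have hl := Nat.unpair_left_le (n / 7)
    have hr := Nat.unpair_right_le (n / 7)
    have hp := Nat.pair_unpair (n / 7)
    have hlt : n % 7 < 7 := Nat.mod_lt _ (by norm_num)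
    by_cases h0 : n % 7 = 0
    · exact ⟨atom (n / 7).unpair.1 (n / 7).unpair.2, by simp only [code]; omega⟩
    obtain ⟨φ, hφ⟩ := ih (n / 7) (by omega)
    obtain ⟨χ₁, h₁⟩ := ih (n / 7).unpair.1 (by omega)
    obtain ⟨χ₂, h₂⟩ := ih (n / 7).unpair.2 (by omega)
    have hc : n % 7 = 1 ∨ n % 7 = 2 ∨ n % 7 = 3 ∨ n % 7 = 4 ∨ n % 7 = 5 ∨ n % 7 = 6 := by
      omega
    rcases hc with h | h | h | h | h | h
    · exact ⟨neg φ, by simp only [code, hφ]; omega⟩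
    · exact ⟨or χ₁ χ₂, by simp only [code, h₁, h₂, hp]; omega⟩
    · exact ⟨next φ, by simp only [code, hφ]; omega⟩
    · exact ⟨untl χ₁ χ₂, by simp only [code, h₁, h₂, hp]; omega⟩
    · exact ⟨ex (n / 7).unpair.1 χ₂, by simp only [code, h₂, hp]; omega⟩
    · exact ⟨all (n / 7).unpair.1 χ₂, by simp only [code, h₂, hp]; omega⟩

/-- Computability of functions on formulas refers to the numbering `code`. -/
noncomputable instance : Denumerable (HyperFormula ℕ) :=
  Denumerable.mk' (Equiv.ofBijective code ⟨code_injective, code_surjective⟩)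

theorem encode_eq_code (φ : HyperFormula ℕ) : Encodable.encode φ = code φ := rfl

end HyperFormula

/-! ## Existential third-order arithmetic -/

/-- Terms over `0, 1, +, ·` with type 0 variables. -/
inductive ArithTerm : Type
  | zero
  | one
  | var (x : ℕ)
  | add (s t : ArithTerm)
  | mul (s t : ArithTerm)

/-- Formulas of second-order arithmetic over `(0, 1, +, ·, <, ∈)` that may mention third-order
variables. Each of the three kinds of variables is indexed by the natural numbers;
`memSet t Y` is `t ∈ Y` and `memFam Y X` is `Y ∈ X` for a third-order variable `X`. -/
inductive ArithFormula : Type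
  | eq (s t : ArithTerm)
  | lt (s t : ArithTerm)
  | memSet (t : ArithTerm) (Y : ℕ)
  | memFam (Y X : ℕ)
  | neg (φ : ArithFormula)
  | or (φ ψ : ArithFormula)
  | exNum (x : ℕ) (φ : ArithFormula)
  | exSet (Y : ℕ) (φ : ArithFormula)

namespace ArithTerm

/-- Value in the natural numbers. -/
def eval (e : ℕ → ℕ) : ArithTerm → ℕ
  | zero => 0
  | one => 1
  | var x => e x
  | add s t => eval e s + eval e t
  | mul s t => eval e s * eval e t

def vars : ArithTerm → Set ℕ
  | zero => ∅
  | one => ∅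
  | var x => {x}
  | add s t => vars s ∪ vars t
  | mul s t => vars s ∪ vars t

/-- Gödel number of a term. -/
def code : ArithTerm → ℕ
  | zero => 0
  | one => 1
  | var x => 3 * x + 2
  | add s t => 3 * Nat.pair (code s) (code t) + 3
  | mul s t => 3 * Nat.pair (code s) (code t) + 4

theorem code_injective : Function.Injective code := by
  intro s
  induction s with
  | zero => intro t h; cases t <;> simp only [code] at h <;> first | rfl | omega
  | one => intro t h; cases t <;> simp only [code] at h <;> first | rfl | omega
  | var x =>
    intro t h
    cases t <;> simp only [code] at h <;> try omega
    congr 1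
    omega
  | add s₁ s₂ ih₁ ih₂ =>
    intro t h
    cases t <;> simp only [code] at h <;> try omega
    simp [Nat.pair_eq_pair] at h
    rw [ih₁ h.1, ih₂ h.2]
  | mul s₁ s₂ ih₁ ih₂ =>
    intro t h
    cases t <;> simp only [code] at h <;> try omega
    simp [Nat.pair_eq_pair] at h
    rw [ih₁ h.1, ih₂ h.2]

theorem code_surjective : Function.Surjective code := by
  intro n
  induction n using Nat.strong_induction_on with
  | _ n ih =>
    by_cases h0 : n = 0
    · exact ⟨zero, by simp only [code]; omega⟩
    by_cases h1 : n = 1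
    · exact ⟨one, by simp only [code]; omega⟩
    have hn := Nat.div_add_mod (n - 2) 3
    have hlt : (n - 2) % 3 < 3 := Nat.mod_lt _ (by norm_num)
    by_cases h2 : (n - 2) % 3 = 0
    · exact ⟨var ((n - 2) / 3), by simp only [code]; omega⟩
    have hl := Nat.unpair_left_le ((n - 2) / 3)
    have hr := Nat.unpair_right_le ((n - 2) / 3)
    have hp := Nat.pair_unpair ((n - 2) / 3)
    obtain ⟨t₁, k₁⟩ := ih ((n - 2) / 3).unpair.1 (by omega)
    obtain ⟨t₂, k₂⟩ := ih ((n - 2) / 3).unpair.2 (by omega)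
    by_cases h3 : (n - 2) % 3 = 1
    · exact ⟨add t₁ t₂, by simp only [code, k₁, k₂, hp]; omega⟩
    · exact ⟨mul t₁ t₂, by simp only [code, k₁, k₂, hp]; omega⟩

noncomputable instance : Denumerable ArithTerm :=
  Denumerable.mk' (Equiv.ofBijective code ⟨code_injective, code_surjective⟩)

theorem encode_eq_code (t : ArithTerm) : Encodable.encode t = code t := rfl

end ArithTerm

namespace ArithFormula

/-- Truth in the standard model: number variables range over `ℕ`, set variables over subsets
of `ℕ`, third-order variables over sets of subsets of `ℕ`. -/
def Holds : ArithFormula → (ℕ → ℕ) → (ℕ → Set ℕ) → (ℕ → Set (Set ℕ)) → Prop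
  | eq s t, e, _, _ => s.eval e = t.eval e
  | lt s t, e, _, _ => s.eval e < t.eval e
  | memSet t Y, e, E, _ => t.eval e ∈ E Y
  | memFam Y X, _, E, F => E Y ∈ F X
  | neg φ, e, E, F => ¬ Holds φ e E F
  | or φ ψ, e, E, F => Holds φ e E F ∨ Holds ψ e E F
  | exNum x φ, e, E, F => ∃ n : ℕ, Holds φ (Function.update e x n) E F
  | exSet Y φ, e, E, F => ∃ A : Set ℕ, Holds φ e (Function.update E Y A) F

/-- Free number variables. -/
def freeNum : ArithFormula → Set ℕ
  | eq s t => s.vars ∪ t.vars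
  | lt s t => s.vars ∪ t.vars
  | memSet t _ => t.vars
  | memFam _ _ => ∅
  | neg φ => freeNum φ
  | or φ ψ => freeNum φ ∪ freeNum ψ
  | exNum x φ => freeNum φ \ {x}
  | exSet _ φ => freeNum φ

/-- Free set variables. -/
def freeSet : ArithFormula → Set ℕ
  | eq _ _ => ∅
  | lt _ _ => ∅
  | memSet _ Y => {Y}
  | memFam Y _ => {Y}
  | neg φ => freeSet φ
  | or φ ψ => freeSet φ ∪ freeSet ψ
  | exNum _ φ => freeSet φ
  | exSet Y φ => freeSet φ \ {Y}

/-- Third-order variables that occur. -/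
def freeFam : ArithFormula → Set ℕ
  | eq _ _ => ∅
  | lt _ _ => ∅
  | memSet _ _ => ∅
  | memFam _ X => {X}
  | neg φ => freeFam φ
  | or φ ψ => freeFam φ ∪ freeFam ψ
  | exNum _ φ => freeFam φ
  | exSet _ φ => freeFam φ

/-- Gödel number of a formula. -/
def code : ArithFormula → ℕ
  | eq s t => 8 * Nat.pair s.code t.code
  | lt s t => 8 * Nat.pair s.code t.code + 1
  | memSet t Y => 8 * Nat.pair t.code Y + 2
  | memFam Y X => 8 * Nat.pair Y X + 3
  | neg φ => 8 * code φ + 4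
  | or φ ψ => 8 * Nat.pair (code φ) (code ψ) + 5
  | exNum x φ => 8 * Nat.pair x (code φ) + 6
  | exSet Y φ => 8 * Nat.pair Y (code φ) + 7

theorem code_injective : Function.Injective code := by
  intro φ
  induction φ with
  | eq s t =>
    intro χ h
    cases χ <;> simp only [code] at h <;> try omega
    simp [Nat.pair_eq_pair] at h
    rw [ArithTerm.code_injective h.1, ArithTerm.code_injective h.2]
  | lt s t =>
    intro χ h
    cases χ <;> simp only [code] at h <;> try omega
    simp [Nat.pair_eq_pair] at h
    rw [ArithTerm.code_injective h.1, ArithTerm.code_injective h.2]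
  | memSet t Y =>
    intro χ h
    cases χ <;> simp only [code] at h <;> try omega
    simp [Nat.pair_eq_pair] at h
    rw [ArithTerm.code_injective h.1, h.2]
  | memFam Y X =>
    intro χ h
    cases χ <;> simp only [code] at h <;> try omega
    simp [Nat.pair_eq_pair] at h
    rw [h.1, h.2]
  | neg φ ih =>
    intro χ h
    cases χ <;> simp only [code] at h <;> try omega
    simp at h
    rw [ih h]
  | or φ ψ ih₁ ih₂ =>
    intro χ h
    cases χ <;> simp only [code] at h <;> try omega
    simp [Nat.pair_eq_pair] at h
    rw [ih₁ h.1, ih₂ h.2]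
  | exNum x φ ih =>
    intro χ h
    cases χ <;> simp only [code] at h <;> try omega
    simp [Nat.pair_eq_pair] at h
    rw [h.1, ih h.2]
  | exSet Y φ ih =>
    intro χ h
    cases χ <;> simp only [code] at h <;> try omega
    simp [Nat.pair_eq_pair] at h
    rw [h.1, ih h.2]

theorem code_surjective : Function.Surjective code := by
  intro n
  induction n using Nat.strong_induction_on with
  | _ n ih =>
    have hn := Nat.div_add_mod n 8
    have hl := Nat.unpair_left_le (n / 8)
    have hr := Nat.unpair_right_le (n / 8)
    have hp := Nat.pair_unpair (n / 8)
    have hlt : n % 8 < 8 := Nat.mod_lt _ (by norm_num)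
    obtain ⟨t₁, k₁⟩ := ArithTerm.code_surjective (n / 8).unpair.1
    obtain ⟨t₂, k₂⟩ := ArithTerm.code_surjective (n / 8).unpair.2
    by_cases h0 : n % 8 = 0
    · exact ⟨eq t₁ t₂, by simp only [code, k₁, k₂, hp]; omega⟩
    obtain ⟨φ, hφ⟩ := ih (n / 8) (by omega)
    obtain ⟨χ₁, h₁⟩ := ih (n / 8).unpair.1 (by omega)
    obtain ⟨χ₂, h₂⟩ := ih (n / 8).unpair.2 (by omega)
    have hc : n % 8 = 1 ∨ n % 8 = 2 ∨ n % 8 = 3 ∨ n % 8 = 4 ∨ n % 8 = 5 ∨ n % 8 = 6 ∨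
        n % 8 = 7 := by
      omega
    rcases hc with h | h | h | h | h | h | h
    · exact ⟨lt t₁ t₂, by simp only [code, k₁, k₂, hp]; omega⟩
    · exact ⟨memSet t₁ (n / 8).unpair.2, by simp only [code, k₁, hp]; omega⟩
    · exact ⟨memFam (n / 8).unpair.1 (n / 8).unpair.2, by simp only [code, hp]; omega⟩
    · exact ⟨neg φ, by simp only [code, hφ]; omega⟩
    · exact ⟨or χ₁ χ₂, by simp only [code, h₁, h₂, hp]; omega⟩
    · exact ⟨exNum (n / 8).unpair.1 χ₂, by simp only [code, h₂, hp]; omega⟩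
    · exact ⟨exSet (n / 8).unpair.1 χ₂, by simp only [code, h₂, hp]; omega⟩

/-- Computability of functions on formulas refers to the numbering `code`. -/
noncomputable instance : Denumerable ArithFormula :=
  Denumerable.mk' (Equiv.ofBijective code ⟨code_injective, code_surjective⟩)

theorem encode_eq_code (φ : ArithFormula) : Encodable.encode φ = code φ := rfl

end ArithFormula

/-- Formulas `∃ X₁ … ∃ Xₙ. ψ` of existential third-order arithmetic: the list of the quantified
third-order variables and the matrix `ψ`. -/
abbrev ExThirdOrder : Type := List ℕ × ArithFormula

namespace ExThirdOrder

/-- Truth of `∃ X₁ … ∃ Xₙ. ψ` when `e`, `E`, `F` interpret the free variables. -/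
def HoldsAux (ψ : ArithFormula) (e : ℕ → ℕ) (E : ℕ → Set ℕ) :
    List ℕ → (ℕ → Set (Set ℕ)) → Prop
  | [], F => ψ.Holds e E F
  | X :: Xs, F => ∃ S : Set (Set ℕ), HoldsAux ψ e E Xs (Function.update F X S)

/-- Truth when the number variables are interpreted by `e` and no other variable is free (the
values given to the set and third-order variables are then irrelevant). -/
def Holds (Φ : ExThirdOrder) (e : ℕ → ℕ) : Prop :=
  HoldsAux Φ.2 e (fun _ => ∅) Φ.1 (fun _ => ∅)

/-- At most the number variables in `s` are free. -/
def FreeIn (Φ : ExThirdOrder) (s : Set ℕ) : Prop :=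
  Φ.2.freeNum ⊆ s ∧ Φ.2.freeSet = ∅ ∧ Φ.2.freeFam ⊆ {X | X ∈ Φ.1}

/-- No variable is free. -/
def IsSentence (Φ : ExThirdOrder) : Prop := FreeIn Φ ∅

/-- Truth of a sentence. -/
def IsTrue (Φ : ExThirdOrder) : Prop := Holds Φ (fun _ => 0)

end ExThirdOrder

/-- `N` is a `Σ²₁` set: it is defined by a formula of existential third-order arithmetic whose
only free variable is the number variable `0`. -/
def IsSigmaTwoOne (N : Set ℕ) : Prop :=
  ∃ Φ : ExThirdOrder, Φ.FreeIn {0} ∧ ∀ n : ℕ, n ∈ N ↔ Φ.Holds (fun _ => n)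

/-- The decision problem with set of instances `I` and set of positive instances `P` is
`Σ²₁`-hard: every `Σ²₁` set is many-one reducible to it. -/
def IsSigmaTwoOneHard {α : Type} [Primcodable α] (I P : Set α) : Prop :=
  ∀ N : Set ℕ, IsSigmaTwoOne N →
    ∃ f : ℕ → α, Computable f ∧ ∀ n, f n ∈ I ∧ (n ∈ N ↔ f n ∈ P)

/-! ## Representing sets and arithmetical operations -/

/-- Propositions used to represent the subsets of `ℕ` by paths. -/
inductive SetProp : Type
  | fbt
  | pset
  | bit0
  | bit1

/-- Propositions used to represent addition and multiplication by traces. -/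
inductive OpProp : Type
  | arg1
  | arg2
  | res
  | add
  | mult

/-- The traces in which `arg1`, `arg2`, `res` hold at exactly one position each, say at `n₁`,
`n₂`, `n₃`, and either `add` holds everywhere, `mult` nowhere and `n₁ + n₂ = n₃`, or `mult` holds
everywhere, `add` nowhere and `n₁ * n₂ = n₃`. -/
def opTraces : Set (ℕ → Set OpProp) :=
  {t | ∃ n₁ n₂ n₃ : ℕ,
    (∀ n, OpProp.arg1 ∈ t n ↔ n = n₁) ∧
    (∀ n, OpProp.arg2 ∈ t n ↔ n = n₂) ∧
    (∀ n, OpProp.res ∈ t n ↔ n = n₃) ∧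
    (((∀ n, OpProp.add ∈ t n ∧ OpProp.mult ∉ t n) ∧ n₁ + n₂ = n₃) ∨
      ((∀ n, OpProp.mult ∈ t n ∧ OpProp.add ∉ t n) ∧ n₁ * n₂ = n₃))}

/-- Every subset `A` of `ℕ` appears in `T` as the labelling of a `pset`-path `r A` from a
successor of the initial vertex, with different first vertices for different subsets. -/
def RepresentsAllSets {V : Type u} (T : TransitionSystem SetProp V) : Prop :=
  ∃ r : Set ℕ → ℕ → V,
    (∀ A, T.IsPath (r A) ∧ T.edge T.init (r A 0) ∧
      ∀ i, SetProp.pset ∈ T.label (r A i) ∧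
        (SetProp.bit1 ∈ T.label (r A i) ↔ i ∈ A) ∧
        (SetProp.bit0 ∈ T.label (r A i) ↔ i ∉ A)) ∧
    Function.Injective (fun A => r A 0)

/-!
The translation of a sentence `∃ X₁ … ∃ Xₙ. ψ` of third-order arithmetic combines three
ingredients.

* Sets of natural numbers are traces, a number being a set with one element. The sentence
  `setSentence` requires a binary branching structure below the initial vertex, in which every
  infinite sequence of bits appears along a path, and for each such path a copy that is
  deterministic from its first vertex on. Hence the first vertex of the copy determines a set
  (`representsAllSets_of_ctlModel`).
* Addition and multiplication are traces that carry two arguments and a result. `opSentence`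
  states that these traces contain `0 + 0 = 0` and `0 * 0 = 0`, are closed under the recursion
  equations in both arguments, and are functional. Closure produces all correct instances, and
  functionality excludes incorrect ones (`ltlSat_opSentence_iff`).
* A third-order variable `X` is a proposition: a set belongs to the family `X` if some trace for
  this set carries the proposition at its first position. The family is thus read off from the
  model, whatever the model is, and the existential third-order quantifiers become the choice of
  a model.

With these, first- and second-order quantifiers of `ψ` become quantifiers over traces, and terms
are evaluated by quantifying over the values of their subterms (`ltlSat_toHyper`). In all these
formulas no quantifier lies in the scope of a temporal operator, so they have the same meaning
over the set of traces of a transition system as in the system itself, up to one step in time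
(`ctlSat_delay`). Conversely, an interpretation of the third-order variables is turned into a
total transition system whose traces are exactly the required ones (`ModelVertex.system`).

The translation is primitive recursive because it follows the recursion of the Gödel numbering
(`primrec_of_subcodes`); the variable for the value of a subterm is computed from the Gödel number
of the subterm. Hardness follows by substituting a numeral for the free variable of a formula.
-/

/-! ### Derived connectives and their semantics -/

namespace HyperFormula

variable {AP AQ : Type} {V : Type u}

/-- Conjunction. -/
def conj (φ ψ : HyperFormula AP) : HyperFormula AP := neg (or (neg φ) (neg ψ))

/-- Implication. -/
def impl (φ ψ : HyperFormula AP) : HyperFormula AP := or (neg φ) ψ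

/-- Equivalence. -/
def equiv (φ ψ : HyperFormula AP) : HyperFormula AP := conj (impl φ ψ) (impl ψ φ)

/-- The temporal operator "eventually". The syntax has no constant for truth, so the left
argument of the until operator is the tautology `φ ∨ ¬ φ`, which adds no free variable. -/
def eventually (φ : HyperFormula AP) : HyperFormula AP := untl (or φ (neg φ)) φ

/-- The temporal operator "always". -/
def always (φ : HyperFormula AP) : HyperFormula AP := neg (eventually (neg φ))

/-- `a` holds at exactly one position of `p`. -/
def once (a : AP) (p : ℕ) : HyperFormula AP :=
  untl (neg (atom a p)) (conj (atom a p) (next (always (neg (atom a p)))))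

/-- At some position `a` holds on `p` and `b` holds on `q`. -/
def meet (a : AP) (p : ℕ) (b : AP) (q : ℕ) : HyperFormula AP :=
  eventually (conj (atom a p) (atom b q))

/-- At some position `a` holds on `p` and `b` holds on `q` one step later. -/
def step (a : AP) (p : ℕ) (b : AP) (q : ℕ) : HyperFormula AP :=
  eventually (conj (atom a p) (next (atom b q)))

/-- Replace every atomic proposition `a` by `g a`. -/
def map (g : AP → AQ) : HyperFormula AP → HyperFormula AQ
  | atom a p => atom (g a) p
  | neg φ => neg (map g φ)
  | or φ ψ => or (map g φ) (map g ψ)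
  | next φ => next (map g φ)
  | untl φ ψ => untl (map g φ) (map g ψ)
  | ex p φ => ex p (map g φ)
  | all p φ => all p (map g φ)

theorem freeVars_map (g : AP → AQ) (φ : HyperFormula AP) : (φ.map g).freeVars = φ.freeVars := by
  induction φ <;> simp_all [map, freeVars]

theorem temporalInScope_map (g : AP → AQ) (φ : HyperFormula AP) :
    (φ.map g).TemporalInScope ↔ φ.TemporalInScope := by
  induction φ <;> simp_all [map, TemporalInScope]

theorem quantifierFree_map (g : AP → AQ) (φ : HyperFormula AP) :
    (φ.map g).QuantifierFree ↔ φ.QuantifierFree := by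
  induction φ <;> simp_all [map, QuantifierFree]

theorem isCTLSentence_map (g : AP → AQ) (φ : HyperFormula AP) :
    (φ.map g).IsCTLSentence ↔ φ.IsCTLSentence := by
  rw [IsCTLSentence, IsCTLSentence, freeVars_map, temporalInScope_map]

/-- Replace every assigned trace by its suffix from position `j` onwards. -/
def shift (P : ℕ → Option (ℕ → Set AP)) (j : ℕ) : ℕ → Option (ℕ → Set AP) :=
  fun p => (P p).map (fun t n => t (n + j))

/-- Position `k` of the trace assigned to `p` carries `a`; false if `p` is not assigned. -/
def At (P : ℕ → Option (ℕ → Set AP)) (p : ℕ) (a : AP) (k : ℕ) : Prop :=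
  ∃ t, P p = some t ∧ a ∈ t k

theorem at_iff {P : ℕ → Option (ℕ → Set AP)} {p : ℕ} {t : ℕ → Set AP} (h : P p = some t)
    (a : AP) (k : ℕ) : At P p a k ↔ a ∈ t k := by
  simp [At, h]

theorem at_update_self (P : ℕ → Option (ℕ → Set AP)) (p : ℕ) (t : ℕ → Set AP) (a : AP) (k : ℕ) :
    At (Function.update P p (some t)) p a k ↔ a ∈ t k := by
  simp [At]

theorem at_update_of_ne (P : ℕ → Option (ℕ → Set AP)) {p q : ℕ} (h : p ≠ q) (t : ℕ → Set AP)
    (a : AP) (k : ℕ) : At (Function.update P q (some t)) p a k ↔ At P p a k := by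
  simp [At, h]

theorem at_shift (P : ℕ → Option (ℕ → Set AP)) (j p : ℕ) (a : AP) (k : ℕ) :
    At (shift P j) p a k ↔ At P p a (k + j) := by
  cases h : P p <;> simp [At, shift, h]

section LTL

variable (S : Set (ℕ → Set AP)) (P : ℕ → Option (ℕ → Set AP)) (φ ψ : HyperFormula AP)

theorem ltlSat_atom (a : AP) (p : ℕ) : LTLSat S (atom a p) P ↔ At P p a 0 := Iff.rfl

theorem ltlSat_neg : LTLSat S (neg φ) P ↔ ¬ LTLSat S φ P := Iff.rfl

theorem ltlSat_or : LTLSat S (or φ ψ) P ↔ LTLSat S φ P ∨ LTLSat S ψ P := Iff.rfl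

theorem ltlSat_ex (p : ℕ) :
    LTLSat S (ex p φ) P ↔ ∃ t ∈ S, LTLSat S φ (Function.update P p (some t)) := Iff.rfl

theorem ltlSat_next : LTLSat S (next φ) P ↔ LTLSat S φ (shift P 1) := Iff.rfl

theorem ltlSat_untl : LTLSat S (untl φ ψ) P ↔
    ∃ j, LTLSat S ψ (shift P j) ∧ ∀ i < j, LTLSat S φ (shift P i) := Iff.rfl

theorem ltlSat_conj : LTLSat S (conj φ ψ) P ↔ LTLSat S φ P ∧ LTLSat S ψ P := by
  simp [conj, LTLSat]

theorem ltlSat_impl : LTLSat S (impl φ ψ) P ↔ (LTLSat S φ P → LTLSat S ψ P) := by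
  simp [impl, LTLSat, imp_iff_not_or]

theorem ltlSat_equiv : LTLSat S (equiv φ ψ) P ↔ (LTLSat S φ P ↔ LTLSat S ψ P) := by
  simp [equiv, ltlSat_conj, ltlSat_impl, iff_iff_implies_and_implies]

theorem ltlSat_eventually : LTLSat S (eventually φ) P ↔ ∃ j, LTLSat S φ (shift P j) := by
  simp [eventually, ltlSat_untl, LTLSat, em]

theorem ltlSat_always : LTLSat S (always φ) P ↔ ∀ j, LTLSat S φ (shift P j) := by
  simp [always, ltlSat_neg, ltlSat_eventually]

theorem ltlSat_once (a : AP) (p : ℕ) :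
    LTLSat S (once a p) P ↔ ∃ n, ∀ k, At P p a k ↔ k = n := by
  simp only [once, ltlSat_untl, ltlSat_conj, ltlSat_next, ltlSat_always, ltlSat_neg,
    ltlSat_atom, at_shift]
  refine exists_congr fun n => ⟨fun ⟨⟨h₀, h₁⟩, h₂⟩ k => ⟨fun hk => ?_, fun hk => ?_⟩,
    fun h => ⟨⟨?_, fun j hj => ?_⟩, fun i hi hj => ?_⟩⟩
  · rcases lt_trichotomy k n with hlt | heq | hgt
    · exact absurd (by simpa using hk) (h₂ k hlt)
    · exact heq
    · refine absurd ?_ (h₁ (k - (n + 1)))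
      rwa [show 0 + (k - (n + 1)) + 1 + n = k by omega]
  · subst hk
    simpa using h₀
  · exact (h _).2 (by omega)
  · have := (h _).1 hj
    omega
  · have := (h _).1 hj
    omega

theorem ltlSat_meet (a : AP) (p : ℕ) (b : AP) (q : ℕ) :
    LTLSat S (meet a p b q) P ↔ ∃ k, At P p a k ∧ At P q b k := by
  simp [meet, ltlSat_eventually, ltlSat_conj, ltlSat_atom, at_shift]

theorem ltlSat_step (a : AP) (p : ℕ) (b : AP) (q : ℕ) :
    LTLSat S (step a p b q) P ↔ ∃ k, At P p a k ∧ At P q b (k + 1) := by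
  simp [step, ltlSat_eventually, ltlSat_conj, ltlSat_next, ltlSat_atom, at_shift, add_comm]

end LTL

/-- Renaming propositions in a formula amounts to pulling back the traces. -/
theorem ltlSat_map (g : AP → AQ) (S : Set (ℕ → Set AQ)) (φ : HyperFormula AP)
    (P : ℕ → Option (ℕ → Set AQ)) :
    LTLSat S (φ.map g) P ↔
      LTLSat ((fun t n => g ⁻¹' t n) '' S) φ (fun p => (P p).map fun t n => g ⁻¹' t n) := by
  have hup : ∀ (P : ℕ → Option (ℕ → Set AQ)) (p : ℕ) (t : ℕ → Set AQ),
      (fun q => (Function.update P p (some t) q).map fun t n => g ⁻¹' t n) =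
        Function.update (fun p => (P p).map fun t n => g ⁻¹' t n) p
          (some fun n => g ⁻¹' t n) := by
    intro P p t
    funext q
    by_cases h : q = p
    · subst h; simp
    · simp [h]
  induction φ generalizing P with
  | atom a p => cases h : P p <;> simp [map, LTLSat, h]
  | neg φ ih => simp [map, LTLSat, ih]
  | or φ ψ ih₁ ih₂ => simp [map, LTLSat, ih₁, ih₂]
  | next φ ih => simp [map, LTLSat, ih, Function.comp_def]
  | untl φ ψ ih₁ ih₂ => simp [map, LTLSat, ih₁, ih₂, Function.comp_def]
  | ex p φ ih => simp [map, LTLSat, ih, hup]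
  | all p φ ih => simp [map, LTLSat, ih, hup]

section CTL

variable (T : TransitionSystem AP V) (P : PathAssignment V) (φ ψ : HyperFormula AP)

theorem ctlSat_conj : CTLSat T (conj φ ψ) P ↔ CTLSat T φ P ∧ CTLSat T ψ P := by
  simp [conj, CTLSat]

theorem ctlSat_impl : CTLSat T (impl φ ψ) P ↔ (CTLSat T φ P → CTLSat T ψ P) := by
  simp [impl, CTLSat, imp_iff_not_or]

theorem ctlSat_equiv : CTLSat T (equiv φ ψ) P ↔ (CTLSat T φ P ↔ CTLSat T ψ P) := by
  simp [equiv, ctlSat_conj, ctlSat_impl, iff_iff_implies_and_implies]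

theorem ctlSat_always : CTLSat T (always φ) P ↔ ∀ j, CTLSat T φ (P.suffix j) := by
  simp [always, eventually, CTLSat]

end CTL

end HyperFormula

/-- The transition system with the labelling pulled back along `g`. -/
def TransitionSystem.comap {AP AQ : Type} {V : Type u} (g : AP → AQ)
    (T : TransitionSystem AQ V) : TransitionSystem AP V :=
  ⟨T.edge, T.init, fun v => g ⁻¹' T.label v⟩

/-- The traces of the paths from the initial vertex, without the label of the initial vertex. -/
def TransitionSystem.traces {AP : Type} {V : Type u} (T : TransitionSystem AP V) :
    Set (ℕ → Set AP) :=
  {t | ∃ r, T.IsPath r ∧ r 0 = T.init ∧ t = fun n => T.label (r (n + 1))}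

namespace HyperFormula

variable {AP AQ : Type} {V : Type u}

/-- Renaming propositions in a formula amounts to pulling back the labelling. -/
theorem ctlSat_map (g : AP → AQ) (T : TransitionSystem AQ V) (φ : HyperFormula AP)
    (P : PathAssignment V) : CTLSat T (φ.map g) P ↔ CTLSat (T.comap g) φ P := by
  induction φ generalizing P with
  | atom a p => simp [map, CTLSat, TransitionSystem.comap]
  | neg φ ih => simp [map, CTLSat, ih]
  | or φ ψ ih₁ ih₂ => simp [map, CTLSat, ih₁, ih₂]
  | next φ ih => simp [map, CTLSat, ih]
  | untl φ ψ ih₁ ih₂ => simp [map, CTLSat, ih₁, ih₂]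
  | ex p φ ih => simp only [map, CTLSat, ih]; rfl
  | all p φ ih => simp only [map, CTLSat, ih]; rfl

/-! ### Evaluating HyperLTL-like formulas in a transition system -/

/-- No quantifier occurs in the scope of a temporal operator. -/
def Flat : HyperFormula AP → Prop
  | atom _ _ => True
  | neg φ => Flat φ
  | or φ ψ => Flat φ ∧ Flat ψ
  | next φ => QuantifierFree φ
  | untl φ ψ => QuantifierFree φ ∧ QuantifierFree ψ
  | ex _ φ => Flat φ
  | all _ φ => Flat φ

/-- Evaluate the maximal quantifier-free temporal subformulas and the remaining atoms one step
later. -/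
def delay : HyperFormula AP → HyperFormula AP
  | atom a p => next (atom a p)
  | neg φ => neg (delay φ)
  | or φ ψ => or (delay φ) (delay ψ)
  | next φ => next (next φ)
  | untl φ ψ => next (untl φ ψ)
  | ex p φ => ex p (delay φ)
  | all p φ => all p (delay φ)

theorem freeVars_delay (φ : HyperFormula AP) : φ.delay.freeVars = φ.freeVars := by
  induction φ <;> simp_all [delay, freeVars]

theorem QuantifierFree.flat {φ : HyperFormula AP} (h : φ.QuantifierFree) : φ.Flat := by
  induction φ <;> simp_all [QuantifierFree, Flat]

theorem Prenex.flat {φ : HyperFormula AP} (h : φ.Prenex) : φ.Flat := by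
  induction h with
  | body φ h => exact h.flat
  | ex p φ _ ih => exact ih
  | all p φ _ ih => exact ih

theorem Flat.map {φ : HyperFormula AP} (h : φ.Flat) (g : AP → AQ) : (φ.map g).Flat := by
  induction φ <;> simp_all [Flat, HyperFormula.map, quantifierFree_map]

theorem ctlSat_of_quantifierFree (T : TransitionSystem AP V) (S : Set (ℕ → Set AP))
    {φ : HyperFormula AP} (h : φ.QuantifierFree) (P : PathAssignment V) :
    CTLSat T φ P ↔ LTLSat S φ (fun p => (P.path p).map fun r n => T.label (r n)) := by
  induction φ generalizing P with
  | atom a p => cases h : P.path p <;> simp [CTLSat, LTLSat, h]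
  | neg φ ih => simp [CTLSat, LTLSat, ih h]
  | or φ ψ ih₁ ih₂ => simp [CTLSat, LTLSat, ih₁ h.1, ih₂ h.2]
  | next φ ih =>
    simp [CTLSat, LTLSat, ih h, PathAssignment.suffix, Function.comp_def]
  | untl φ ψ ih₁ ih₂ =>
    simp [CTLSat, LTLSat, ih₁ h.1, ih₂ h.2, PathAssignment.suffix, Function.comp_def]
  | ex p φ => exact h.elim
  | all p φ => exact h.elim

/-- As long as no quantifier is in the scope of a temporal operator, all quantifiers range over
the paths from the initial vertex, so that the HyperCTL* semantics is the HyperLTL semantics on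
the traces of the system. -/
theorem ctlSat_delay (T : TransitionSystem AP V) {φ : HyperFormula AP} (h : φ.Flat)
    (P : PathAssignment V) (hP : P.recent T.init = T.init) :
    CTLSat T φ.delay P ↔
      LTLSat T.traces φ (fun p => (P.path p).map fun r n => T.label (r (n + 1))) := by
  have hqf : ∀ {χ : HyperFormula AP} (_ : χ.QuantifierFree) (P : PathAssignment V),
      CTLSat T (next χ) P ↔
        LTLSat T.traces χ (fun p => (P.path p).map fun r n => T.label (r (n + 1))) := by
    intro χ hχ P
    rw [CTLSat, ctlSat_of_quantifierFree T T.traces hχ]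
    simp [PathAssignment.suffix, Function.comp_def]
  have hup : ∀ (P : PathAssignment V) (p : ℕ) (r : ℕ → V),
      (fun q => ((P.assign p r).path q).map fun r n => T.label (r (n + 1))) =
        Function.update (fun q => (P.path q).map fun r n => T.label (r (n + 1))) p
          (some fun n => T.label (r (n + 1))) := by
    intro P p r
    funext q
    by_cases h : q = p
    · subst h; simp [PathAssignment.assign]
    · simp [PathAssignment.assign, h]
  have hrec : ∀ (P : PathAssignment V) (p : ℕ) (r : ℕ → V),
      (P.assign p r).recent T.init = r 0 := by
    intro P p r
    simp [PathAssignment.assign, PathAssignment.recent]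
  induction φ generalizing P with
  | atom a p => exact hqf (χ := atom a p) trivial P
  | neg φ ih => exact not_congr (ih h P hP)
  | or φ ψ ih₁ ih₂ => exact or_congr (ih₁ h.1 P hP) (ih₂ h.2 P hP)
  | next φ => exact hqf (χ := next φ) h P
  | untl φ ψ => exact hqf (χ := untl φ ψ) h P
  | ex p φ ih =>
    simp only [delay, CTLSat, LTLSat, hP]
    constructor
    · rintro ⟨r, h₁, h₂, h₃⟩
      exact ⟨_, ⟨r, h₁, h₂, rfl⟩, hup P p r ▸ (ih h (P.assign p r) ((hrec P p r).trans h₂)).1 h₃⟩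
    · rintro ⟨_, ⟨r, h₁, h₂, rfl⟩, h₃⟩
      exact ⟨r, h₁, h₂,
        (ih h (P.assign p r) ((hrec P p r).trans h₂)).2 ((hup P p r).symm ▸ h₃)⟩
  | all p φ ih =>
    simp only [delay, CTLSat, LTLSat, hP]
    constructor
    · rintro h₃ _ ⟨r, h₁, h₂, rfl⟩
      exact hup P p r ▸ (ih h (P.assign p r) ((hrec P p r).trans h₂)).1 (h₃ r h₁ h₂)
    · intro h₃ r h₁ h₂
      exact (ih h (P.assign p r) ((hrec P p r).trans h₂)).2
        ((hup P p r).symm ▸ h₃ _ ⟨r, h₁, h₂, rfl⟩)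

end HyperFormula

/-! ### Addition and multiplication -/

/-- The trace on which `arg1`, `arg2`, `res` hold exactly at `a₁`, `a₂`, `a₃`, and `mult` (for
`b = true`) or `add` (for `b = false`) holds everywhere. -/
def opTrace (b : Bool) (a₁ a₂ a₃ : ℕ) : ℕ → Set OpProp := fun n => fun o =>
  match o with
  | OpProp.arg1 => n = a₁
  | OpProp.arg2 => n = a₂
  | OpProp.res => n = a₃
  | OpProp.add => b = false
  | OpProp.mult => b = true

section opTrace

variable (b : Bool) (a₁ a₂ a₃ n : ℕ)

@[simp] theorem arg1_mem_opTrace : OpProp.arg1 ∈ opTrace b a₁ a₂ a₃ n ↔ n = a₁ := Iff.rfl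
@[simp] theorem arg2_mem_opTrace : OpProp.arg2 ∈ opTrace b a₁ a₂ a₃ n ↔ n = a₂ := Iff.rfl
@[simp] theorem res_mem_opTrace : OpProp.res ∈ opTrace b a₁ a₂ a₃ n ↔ n = a₃ := Iff.rfl
@[simp] theorem add_mem_opTrace : OpProp.add ∈ opTrace b a₁ a₂ a₃ n ↔ b = false := Iff.rfl
@[simp] theorem mult_mem_opTrace : OpProp.mult ∈ opTrace b a₁ a₂ a₃ n ↔ b = true := Iff.rfl

theorem eq_opTrace_iff {t : ℕ → Set OpProp} : t = opTrace b a₁ a₂ a₃ ↔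
    (∀ n, OpProp.arg1 ∈ t n ↔ n = a₁) ∧ (∀ n, OpProp.arg2 ∈ t n ↔ n = a₂) ∧
    (∀ n, OpProp.res ∈ t n ↔ n = a₃) ∧ (∀ n, OpProp.add ∈ t n ↔ b = false) ∧
    (∀ n, OpProp.mult ∈ t n ↔ b = true) := by
  constructor
  · rintro rfl
    simp
  · rintro ⟨h₁, h₂, h₃, h₄, h₅⟩
    funext n
    ext o
    cases o <;> simp [h₁, h₂, h₃, h₄, h₅]

theorem opTrace_mem_opTraces_iff :
    opTrace b a₁ a₂ a₃ ∈ opTraces ↔ a₃ = if b then a₁ * a₂ else a₁ + a₂ := by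
  constructor
  · rintro ⟨n₁, n₂, n₃, h₁, h₂, h₃, h₄⟩
    obtain rfl : a₁ = n₁ := (h₁ a₁).1 (by simp)
    obtain rfl : a₂ = n₂ := (h₂ a₂).1 (by simp)
    obtain rfl : a₃ = n₃ := (h₃ a₃).1 (by simp)
    cases b <;> simp at h₄ ⊢ <;> exact h₄.symm
  · rintro rfl
    refine ⟨a₁, a₂, _, by simp, by simp, fun _ => Iff.rfl, ?_⟩
    cases b <;> simp

theorem mem_opTraces_iff {t : ℕ → Set OpProp} : t ∈ opTraces ↔
    ∃ b a₁ a₂, t = opTrace b a₁ a₂ (if b then a₁ * a₂ else a₁ + a₂) := by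
  constructor
  · rintro ⟨n₁, n₂, n₃, h₁, h₂, h₃, ⟨h₄, rfl⟩ | ⟨h₄, rfl⟩⟩
    · exact ⟨false, n₁, n₂, (eq_opTrace_iff ..).2 ⟨h₁, h₂, h₃, by simp [h₄], by simp [h₄]⟩⟩
    · exact ⟨true, n₁, n₂, (eq_opTrace_iff ..).2 ⟨h₁, h₂, h₃, by simp [h₄], by simp [h₄]⟩⟩
  · rintro ⟨b, a₁, a₂, rfl⟩
    rw [opTrace_mem_opTraces_iff]

end opTrace

/-- The traces that claim to represent an operation. -/
def IsOpTrace (t : ℕ → Set OpProp) : Prop := OpProp.add ∈ t 0 ∨ OpProp.mult ∈ t 0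

theorem isOpTrace_opTrace (b : Bool) (a₁ a₂ a₃ : ℕ) : IsOpTrace (opTrace b a₁ a₂ a₃) := by
  cases b <;> simp [IsOpTrace]

namespace HyperFormula

open OpProp

/-- The trace `p` claims to represent an operation. -/
def isOp (p : ℕ) : HyperFormula OpProp := or (atom add p) (atom mult p)

/-- The trace `p` has the shape of `opTrace`. -/
def wellFormed (p : ℕ) : HyperFormula OpProp :=
  conj (once arg1 p) (conj (once arg2 p) (conj (once res p)
    (or (always (conj (atom add p) (neg (atom mult p))))
      (always (conj (atom mult p) (neg (atom add p)))))))

/-- On the trace `p`, which represents the operation `o`, both arguments and the result are 0. -/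
def zeros (o : OpProp) (p : ℕ) : HyperFormula OpProp :=
  conj (atom o p) (conj (atom arg1 p) (conj (atom arg2 p) (atom res p)))

/-- If `p` and `q` agree on the operation and on the arguments, they agree on the result. -/
def functional (p q : ℕ) : HyperFormula OpProp :=
  impl
    (conj (or (conj (atom add p) (atom add q)) (conj (atom mult p) (atom mult q)))
      (conj (meet arg1 p arg1 q) (meet arg2 p arg2 q)))
    (meet res p res q)

/-- The recursion for addition: if `p` states `a + b = c`, then `q` states `(a + 1) + b = c + 1`
and `q'` states `a + (b + 1) = c + 1`. -/
def addStep (p q q' : ℕ) : HyperFormula OpProp :=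
  impl (atom add p)
    (conj
      (conj (atom add q)
        (conj (step arg1 p arg1 q) (conj (meet arg2 p arg2 q) (step res p res q))))
      (conj (atom add q')
        (conj (meet arg1 p arg1 q') (conj (step arg2 p arg2 q') (step res p res q')))))

/-- The recursion for multiplication: if `p` states `a * b = c`, then `q` states
`(a + 1) * b = d` and `q'` states `a * (b + 1) = d'`, where `s` states `c + b = d` and `s'` states
`c + a = d'`. -/
def multStep (p q q' s s' : ℕ) : HyperFormula OpProp :=
  impl (atom mult p)
    (conj
      (conj (conj (atom mult q) (conj (step arg1 p arg1 q) (meet arg2 p arg2 q)))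
        (conj (atom add s)
          (conj (meet res p arg1 s) (conj (meet arg2 p arg2 s) (meet res s res q)))))
      (conj (conj (atom mult q') (conj (meet arg1 p arg1 q') (step arg2 p arg2 q')))
        (conj (atom add s')
          (conj (meet res p arg1 s') (conj (meet arg1 p arg2 s') (meet res s' res q'))))))

/-- The quantifier-free part of `opSentence`. -/
def opMatrix : HyperFormula OpProp :=
  conj (conj (zeros add 0) (zeros mult 1))
    (impl (conj (isOp 2) (isOp 3))
      (conj (wellFormed 2) (conj (functional 2 3) (conj (addStep 2 4 5) (multStep 2 4 5 6 7)))))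

/-- The quantifiers of `opSentence`. -/
def opPrefix {AP : Type} (φ : HyperFormula AP) : HyperFormula AP :=
  ex 0 (ex 1 (all 2 (all 3 (ex 4 (ex 5 (ex 6 (ex 7 φ)))))))

/-- The traces that claim to represent an operation are exactly those in `opTraces`. -/
def opSentence : HyperFormula OpProp := opPrefix opMatrix

/-- The only model is `opTraces`. -/
def opOnlySentence : HyperFormula OpProp := opPrefix (conj (isOp 2) opMatrix)

variable (S : Set (ℕ → Set OpProp)) (P : ℕ → Option (ℕ → Set OpProp))

theorem ltlSat_wellFormed {p : ℕ} {t : ℕ → Set OpProp} (h : P p = some t) :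
    LTLSat S (wellFormed p) P ↔ ∃ b a₁ a₂ a₃, t = opTrace b a₁ a₂ a₃ := by
  simp only [wellFormed, ltlSat_conj, ltlSat_once, ltlSat_or, ltlSat_always, ltlSat_neg,
    ltlSat_atom, at_shift, at_iff h, eq_opTrace_iff, zero_add]
  constructor
  · rintro ⟨⟨n₁, h₁⟩, ⟨n₂, h₂⟩, ⟨n₃, h₃⟩, h₄ | h₄⟩
    · exact ⟨false, n₁, n₂, n₃, h₁, h₂, h₃, by simp [h₄], by simp [h₄]⟩
    · exact ⟨true, n₁, n₂, n₃, h₁, h₂, h₃, by simp [h₄], by simp [h₄]⟩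
  · rintro ⟨b, n₁, n₂, n₃, h₁, h₂, h₃, h₄, h₅⟩
    refine ⟨⟨n₁, h₁⟩, ⟨n₂, h₂⟩, ⟨n₃, h₃⟩, ?_⟩
    cases b <;> simp [h₄, h₅]

theorem ltlSat_isOp {p : ℕ} {t : ℕ → Set OpProp} (h : P p = some t) :
    LTLSat S (isOp p) P ↔ IsOpTrace t := by
  simp only [isOp, ltlSat_or, ltlSat_atom, at_iff h, IsOpTrace]

theorem ltlSat_zeros (o : OpProp) {p : ℕ} {t : ℕ → Set OpProp} (h : P p = some t) :
    LTLSat S (zeros o p) P ↔ o ∈ t 0 ∧ arg1 ∈ t 0 ∧ arg2 ∈ t 0 ∧ res ∈ t 0 := by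
  simp only [zeros, ltlSat_conj, ltlSat_atom, at_iff h]

theorem ltlSat_functional {p q : ℕ} {b b' : Bool} {a₁ a₂ a₃ a₁' a₂' a₃' : ℕ}
    (hp : P p = some (opTrace b a₁ a₂ a₃)) (hq : P q = some (opTrace b' a₁' a₂' a₃')) :
    LTLSat S (functional p q) P ↔ (b = b' → a₁ = a₁' → a₂ = a₂' → a₃ = a₃') := by
  simp only [functional, ltlSat_impl, ltlSat_conj, ltlSat_or, ltlSat_atom, ltlSat_meet,
    at_iff hp, at_iff hq, arg1_mem_opTrace, arg2_mem_opTrace, res_mem_opTrace, add_mem_opTrace,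
    mult_mem_opTrace, exists_eq_left]
  cases b <;> cases b' <;> simp

theorem ltlSat_addStep {p q q' : ℕ} {b : Bool} {a₁ a₂ a₃ : ℕ} {t t' : ℕ → Set OpProp}
    (hp : P p = some (opTrace b a₁ a₂ a₃)) (hq : P q = some t) (hq' : P q' = some t') :
    LTLSat S (addStep p q q') P ↔ (b = false →
      (add ∈ t 0 ∧ arg1 ∈ t (a₁ + 1) ∧ arg2 ∈ t a₂ ∧ res ∈ t (a₃ + 1)) ∧
      (add ∈ t' 0 ∧ arg1 ∈ t' a₁ ∧ arg2 ∈ t' (a₂ + 1) ∧ res ∈ t' (a₃ + 1))) := by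
  simp only [addStep, ltlSat_impl, ltlSat_conj, ltlSat_atom, ltlSat_meet, ltlSat_step,
    at_iff hp, at_iff hq, at_iff hq', arg1_mem_opTrace, arg2_mem_opTrace, res_mem_opTrace,
    add_mem_opTrace, exists_eq_left]

theorem ltlSat_multStep {p q q' s s' : ℕ} {b : Bool} {a₁ a₂ a₃ : ℕ} {t t' w w' : ℕ → Set OpProp}
    (hp : P p = some (opTrace b a₁ a₂ a₃)) (hq : P q = some t) (hq' : P q' = some t')
    (hs : P s = some w) (hs' : P s' = some w') :
    LTLSat S (multStep p q q' s s') P ↔ (b = true →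
      ((mult ∈ t 0 ∧ arg1 ∈ t (a₁ + 1) ∧ arg2 ∈ t a₂) ∧
        add ∈ w 0 ∧ arg1 ∈ w a₃ ∧ arg2 ∈ w a₂ ∧ ∃ d, res ∈ w d ∧ res ∈ t d) ∧
      ((mult ∈ t' 0 ∧ arg1 ∈ t' a₁ ∧ arg2 ∈ t' (a₂ + 1)) ∧
        add ∈ w' 0 ∧ arg1 ∈ w' a₃ ∧ arg2 ∈ w' a₁ ∧ ∃ d, res ∈ w' d ∧ res ∈ t' d)) := by
  simp only [multStep, ltlSat_impl, ltlSat_conj, ltlSat_atom, ltlSat_meet, ltlSat_step,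
    at_iff hp, at_iff hq, at_iff hq', at_iff hs, at_iff hs', arg1_mem_opTrace, arg2_mem_opTrace,
    res_mem_opTrace, mult_mem_opTrace, exists_eq_left]

/-- The assignment reached below the quantifiers of `opSentence`. -/
def opAssign {AP : Type} (P : ℕ → Option (ℕ → Set AP)) (p₀ p₁ x y z₁ z₂ z₃ z₄ : ℕ → Set AP) :
    ℕ → Option (ℕ → Set AP) :=
  Function.update (Function.update (Function.update (Function.update (Function.update
    (Function.update (Function.update (Function.update P 0 (some p₀)) 1 (some p₁)) 2 (some x))
      3 (some y)) 4 (some z₁)) 5 (some z₂)) 6 (some z₃)) 7 (some z₄)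

theorem ltlSat_opPrefix (φ : HyperFormula OpProp) :
    LTLSat S (opPrefix φ) P ↔ ∃ p₀ ∈ S, ∃ p₁ ∈ S, ∀ x ∈ S, ∀ y ∈ S, ∃ z₁ ∈ S, ∃ z₂ ∈ S, ∃ z₃ ∈ S,
      ∃ z₄ ∈ S, LTLSat S φ (opAssign P p₀ p₁ x y z₁ z₂ z₃ z₄) := Iff.rfl

theorem ltlSat_opMatrix (p₀ p₁ x y z₁ z₂ z₃ z₄ : ℕ → Set OpProp) :
    LTLSat S opMatrix (opAssign P p₀ p₁ x y z₁ z₂ z₃ z₄) ↔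
      ((add ∈ p₀ 0 ∧ arg1 ∈ p₀ 0 ∧ arg2 ∈ p₀ 0 ∧ res ∈ p₀ 0) ∧
        (mult ∈ p₁ 0 ∧ arg1 ∈ p₁ 0 ∧ arg2 ∈ p₁ 0 ∧ res ∈ p₁ 0)) ∧
      (IsOpTrace x ∧ IsOpTrace y → (∃ b a₁ a₂ a₃, x = opTrace b a₁ a₂ a₃) ∧
        LTLSat S (functional 2 3) (opAssign P p₀ p₁ x y z₁ z₂ z₃ z₄) ∧
        LTLSat S (addStep 2 4 5) (opAssign P p₀ p₁ x y z₁ z₂ z₃ z₄) ∧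
        LTLSat S (multStep 2 4 5 6 7) (opAssign P p₀ p₁ x y z₁ z₂ z₃ z₄)) := by
  rw [opMatrix, ltlSat_conj, ltlSat_conj, ltlSat_impl, ltlSat_conj, ltlSat_conj, ltlSat_conj,
    ltlSat_conj, ltlSat_zeros S _ add (t := p₀) rfl, ltlSat_zeros S _ mult (t := p₁) rfl,
    ltlSat_isOp S _ (t := x) rfl, ltlSat_isOp S _ (t := y) rfl,
    ltlSat_wellFormed S _ (t := x) rfl]

/-- The base cases and the recursions for addition and multiplication generate all of
`opTraces`, and functionality excludes everything else. -/
theorem ltlSat_opSentence_iff :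
    LTLSat S opSentence P ↔ {t | t ∈ S ∧ IsOpTrace t} = opTraces := by
  rw [opSentence, ltlSat_opPrefix]
  simp only [ltlSat_opMatrix]
  constructor
  · rintro ⟨p₀, hp₀, p₁, hp₁, h⟩
    have hzero : (add ∈ p₀ 0 ∧ arg1 ∈ p₀ 0 ∧ arg2 ∈ p₀ 0 ∧ res ∈ p₀ 0) ∧
        (mult ∈ p₁ 0 ∧ arg1 ∈ p₁ 0 ∧ arg2 ∈ p₁ 0 ∧ res ∈ p₁ 0) := by
      obtain ⟨_, _, _, _, _, _, _, _, h, _⟩ := h p₀ hp₀ p₀ hp₀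
      exact h
    have hwf : ∀ x ∈ S, IsOpTrace x → ∃ b a₁ a₂ a₃, x = opTrace b a₁ a₂ a₃ := by
      intro x hx hop
      obtain ⟨_, _, _, _, _, _, _, _, _, h⟩ := h x hx x hx
      exact (h ⟨hop, hop⟩).1
    -- a trace of `S` is determined by the positions at which the propositions are known to hold
    have hdet : ∀ t ∈ S, ∀ (b : Bool) (a₁ a₂ a₃ : ℕ), (if b then mult else add) ∈ t 0 →
        arg1 ∈ t a₁ → arg2 ∈ t a₂ → res ∈ t a₃ → opTrace b a₁ a₂ a₃ ∈ S := by
      intro t ht b a₁ a₂ a₃ h₀ h₁ h₂ h₃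
      have hop : IsOpTrace t := by cases b <;> simp_all [IsOpTrace]
      obtain ⟨b', a₁', a₂', a₃', rfl⟩ := hwf t ht hop
      rw [arg1_mem_opTrace] at h₁
      rw [arg2_mem_opTrace] at h₂
      rw [res_mem_opTrace] at h₃
      obtain rfl : b = b' := by cases b <;> simp_all
      subst h₁ h₂ h₃
      exact ht
    have hres : ∀ t ∈ S, IsOpTrace t → ∃ a₃, res ∈ t a₃ := by
      intro t ht hop
      obtain ⟨b', a₁', a₂', a₃', rfl⟩ := hwf t ht hop
      exact ⟨a₃', rfl⟩
    have hfun : ∀ b a₁ a₂ a₃ a₃', opTrace b a₁ a₂ a₃ ∈ S → opTrace b a₁ a₂ a₃' ∈ S →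
        a₃ = a₃' := by
      intro b a₁ a₂ a₃ a₃' hx hy
      obtain ⟨_, _, _, _, _, _, _, _, _, h⟩ := h _ hx _ hy
      have := (h ⟨isOpTrace_opTrace .., isOpTrace_opTrace ..⟩).2.1
      rw [ltlSat_functional S _ rfl rfl] at this
      exact this rfl rfl rfl
    have hadd : ∀ a₁ a₂ a₃, opTrace false a₁ a₂ a₃ ∈ S →
        opTrace false (a₁ + 1) a₂ (a₃ + 1) ∈ S ∧ opTrace false a₁ (a₂ + 1) (a₃ + 1) ∈ S := by
      intro a₁ a₂ a₃ hx
      obtain ⟨z₁, hz₁, z₂, hz₂, _, _, _, _, _, h⟩ := h _ hx _ hx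
      have := (h ⟨isOpTrace_opTrace .., isOpTrace_opTrace ..⟩).2.2.1
      rw [ltlSat_addStep S _ rfl rfl rfl] at this
      obtain ⟨⟨h₁, h₂, h₃, h₄⟩, h₅, h₆, h₇, h₈⟩ := this rfl
      exact ⟨hdet z₁ hz₁ false _ _ _ h₁ h₂ h₃ h₄, hdet z₂ hz₂ false _ _ _ h₅ h₆ h₇ h₈⟩
    have hmult : ∀ a₁ a₂ a₃, opTrace true a₁ a₂ a₃ ∈ S →
        (∃ d, opTrace true (a₁ + 1) a₂ d ∈ S ∧ opTrace false a₃ a₂ d ∈ S) ∧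
        (∃ d, opTrace true a₁ (a₂ + 1) d ∈ S ∧ opTrace false a₃ a₁ d ∈ S) := by
      intro a₁ a₂ a₃ hx
      obtain ⟨z₁, hz₁, z₂, hz₂, z₃, hz₃, z₄, hz₄, _, h⟩ := h _ hx _ hx
      have := (h ⟨isOpTrace_opTrace .., isOpTrace_opTrace ..⟩).2.2.2
      rw [ltlSat_multStep S _ rfl rfl rfl rfl rfl] at this
      obtain ⟨⟨⟨h₁, h₂, h₃⟩, h₄, h₅, h₆, d, h₇, h₈⟩, ⟨k₁, k₂, k₃⟩, k₄, k₅, k₆, d', k₇, k₈⟩ :=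
        this rfl
      exact ⟨⟨d, hdet z₁ hz₁ true _ _ _ h₁ h₂ h₃ h₈, hdet z₃ hz₃ false _ _ _ h₄ h₅ h₆ h₇⟩,
        ⟨d', hdet z₂ hz₂ true _ _ _ k₁ k₂ k₃ k₈, hdet z₄ hz₄ false _ _ _ k₄ k₅ k₆ k₇⟩⟩
    have hadd' : ∀ a b, opTrace false a b (a + b) ∈ S := by
      intro a b
      induction a with
      | zero =>
        induction b with
        | zero => exact hdet p₀ hp₀ false 0 0 0 hzero.1.1 hzero.1.2.1 hzero.1.2.2.1 hzero.1.2.2.2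
        | succ b ih => exact (hadd _ _ _ ih).2
      | succ a ih =>
        rw [Nat.add_right_comm]
        exact (hadd _ _ _ ih).1
    have hmult' : ∀ a b, opTrace true a b (a * b) ∈ S := by
      intro a b
      induction a with
      | zero =>
        induction b with
        | zero => exact hdet p₁ hp₁ true 0 0 0 hzero.2.1 hzero.2.2.1 hzero.2.2.2.1 hzero.2.2.2.2
        | succ b ih =>
          obtain ⟨_, d, hd, hd'⟩ := hmult _ _ _ ih
          rw [hfun _ _ _ _ _ hd' (hadd' _ _)] at hd
          simpa using hd
      | succ a ih =>
        obtain ⟨⟨d, hd, hd'⟩, _⟩ := hmult _ _ _ ih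
        rw [hfun _ _ _ _ _ hd' (hadd' _ _)] at hd
        rwa [Nat.succ_mul]
    ext t
    rw [Set.mem_ofPred_eq, mem_opTraces_iff]
    constructor
    · rintro ⟨ht, hop⟩
      obtain ⟨b, a₁, a₂, a₃, rfl⟩ := hwf t ht hop
      refine ⟨b, a₁, a₂, ?_⟩
      cases b
      · rw [hfun _ _ _ _ _ ht (hadd' _ _)]; rfl
      · rw [hfun _ _ _ _ _ ht (hmult' _ _)]; rfl
    · rintro ⟨b, a₁, a₂, rfl⟩
      refine ⟨?_, isOpTrace_opTrace ..⟩
      cases b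
      · exact hadd' _ _
      · exact hmult' _ _
  · intro h
    have hmem : ∀ b a₁ a₂, opTrace b a₁ a₂ (if b then a₁ * a₂ else a₁ + a₂) ∈ S := fun b a₁ a₂ =>
      ((Set.ext_iff.1 h _).2 ((opTrace_mem_opTraces_iff ..).2 rfl)).1
    have hadd : ∀ a₁ a₂, opTrace false a₁ a₂ (a₁ + a₂) ∈ S := fun a₁ a₂ => hmem false a₁ a₂
    have hmult : ∀ a₁ a₂, opTrace true a₁ a₂ (a₁ * a₂) ∈ S := fun a₁ a₂ => hmem true a₁ a₂
    refine ⟨_, hadd 0 0, _, hmult 0 0, fun x hx y hy => ?_⟩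
    by_cases hop : IsOpTrace x ∧ IsOpTrace y
    · obtain ⟨b, a₁, a₂, rfl⟩ := mem_opTraces_iff.1 ((Set.ext_iff.1 h x).1 ⟨hx, hop.1⟩)
      obtain ⟨b', a₁', a₂', rfl⟩ := mem_opTraces_iff.1 ((Set.ext_iff.1 h y).1 ⟨hy, hop.2⟩)
      refine ⟨_, hmem b (a₁ + 1) a₂, _, hmem b a₁ (a₂ + 1), _, hadd (a₁ * a₂) a₂, _,
        hadd (a₁ * a₂) a₁, by simp, fun _ => ⟨⟨_, _, _, _, rfl⟩, ?_, ?_, ?_⟩⟩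
      · rw [ltlSat_functional S _ rfl rfl]
        rintro rfl rfl rfl
        rfl
      · rw [ltlSat_addStep S _ rfl rfl rfl]
        rintro rfl
        simp
        omega
      · rw [ltlSat_multStep S _ rfl rfl rfl rfl rfl]
        rintro rfl
        simp [Nat.succ_mul, Nat.mul_succ]
    · -- nothing is required of the last four traces
      exact ⟨x, hx, x, hx, x, hx, x, hx, by simp, fun h => absurd h hop⟩

theorem ltlModel_opOnlySentence_iff : LTLModel S opOnlySentence ↔ S = opTraces := by
  have hsub : LTLModel S opOnlySentence ↔
      LTLSat S opSentence (fun _ => none) ∧ ∀ t ∈ S, IsOpTrace t := by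
    rw [LTLModel, opOnlySentence, opSentence, ltlSat_opPrefix, ltlSat_opPrefix]
    simp only [ltlSat_conj, fun p₀ p₁ x y z₁ z₂ z₃ z₄ =>
      ltlSat_isOp S (opAssign (fun _ => none) p₀ p₁ x y z₁ z₂ z₃ z₄) (p := 2) (t := x) rfl]
    constructor
    · rintro ⟨p₀, hp₀, p₁, hp₁, h⟩
      refine ⟨⟨p₀, hp₀, p₁, hp₁, fun x hx y hy => ?_⟩, fun x hx => ?_⟩
      · obtain ⟨z₁, hz₁, z₂, hz₂, z₃, hz₃, z₄, hz₄, h⟩ := h x hx y hy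
        exact ⟨z₁, hz₁, z₂, hz₂, z₃, hz₃, z₄, hz₄, h.2⟩
      · obtain ⟨z₁, hz₁, z₂, hz₂, z₃, hz₃, z₄, hz₄, h⟩ := h x hx x hx
        exact h.1
    · rintro ⟨⟨p₀, hp₀, p₁, hp₁, h⟩, hop⟩
      refine ⟨p₀, hp₀, p₁, hp₁, fun x hx y hy => ?_⟩
      obtain ⟨z₁, hz₁, z₂, hz₂, z₃, hz₃, z₄, hz₄, h⟩ := h x hx y hy
      exact ⟨z₁, hz₁, z₂, hz₂, z₃, hz₃, z₄, hz₄, hop x hx, h⟩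
  rw [hsub, ltlSat_opSentence_iff]
  constructor
  · rintro ⟨h, hop⟩
    rw [← h]
    ext t
    exact ⟨fun ht => ⟨ht, hop t ht⟩, fun ht => ht.1⟩
  · rintro rfl
    have hop : ∀ t ∈ opTraces, IsOpTrace t := by
      intro t ht
      obtain ⟨b, a₁, a₂, rfl⟩ := mem_opTraces_iff.1 ht
      exact isOpTrace_opTrace ..
    exact ⟨Set.ext fun t => ⟨fun ht => ht.1, fun ht => ⟨ht, hop t ht⟩⟩, hop⟩

theorem quantifierFree_opMatrix : opMatrix.QuantifierFree := by
  simp [opMatrix, zeros, isOp, wellFormed, functional, addStep, multStep, once, meet, step, always,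
    eventually, conj, impl, QuantifierFree]

theorem freeVars_opMatrix : opMatrix.freeVars ⊆ Set.Iio 8 := by
  simp [opMatrix, zeros, isOp, wellFormed, functional, addStep, multStep, once, meet, step, always,
    eventually, conj, impl, freeVars, Set.insert_subset_iff]

theorem freeVars_opPrefix {AP : Type} {φ : HyperFormula AP} (h : φ.freeVars ⊆ Set.Iio 8) :
    (opPrefix φ).freeVars = ∅ := by
  simp only [opPrefix, freeVars, Set.eq_empty_iff_forall_notMem, Set.mem_sdiff,
    Set.mem_singleton_iff]
  intro n hn
  have := Set.mem_Iio.1 (h hn.1.1.1.1.1.1.1.1)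
  omega

theorem prenex_opPrefix {AP : Type} {φ : HyperFormula AP} (h : φ.QuantifierFree) :
    (opPrefix φ).Prenex :=
  .ex _ _ (.ex _ _ (.all _ _ (.all _ _ (.ex _ _ (.ex _ _ (.ex _ _ (.ex _ _ (.body _ h))))))))

theorem isLTLSentence_opOnlySentence : opOnlySentence.IsLTLSentence := by
  refine ⟨prenex_opPrefix ?_, freeVars_opPrefix ?_⟩
  · simpa [conj, isOp, QuantifierFree] using quantifierFree_opMatrix
  · simpa [conj, isOp, freeVars, Set.insert_subset_iff] using freeVars_opMatrix

end HyperFormula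

/-! ### A sentence that forces all sets of natural numbers to appear -/

namespace HyperFormula

open SetProp

/-- From the current vertex of `p` there is an `fbt`-successor that carries `a` but not `b`. -/
def branch (a b : SetProp) (p : ℕ) : HyperFormula SetProp :=
  ex p (next (conj (atom fbt p) (conj (atom a p) (neg (atom b p)))))

/-- The conjunction of four requirements: the initial vertex is an `fbt`-vertex on some path;
every `fbt`-vertex on a path from the initial vertex has `fbt`-successors for both bits; the bits
of every `fbt`-path are copied by a `pset`-path; and all paths that begin in the same
`pset`-successor of the initial vertex carry the same bits. -/
def setSentence : HyperFormula SetProp :=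
  conj (ex 0 (atom fbt 0))
    (conj (all 0 (always (impl (atom fbt 0) (conj (branch bit1 bit0 1) (branch bit0 bit1 1)))))
      (conj
        (all 0 (impl (next (always (atom fbt 0)))
          (ex 1 (next (always (conj (atom pset 1)
            (conj (equiv (atom bit1 0) (atom bit1 1)) (equiv (atom bit0 0) (atom bit0 1)))))))))
        (all 0 (next (impl (atom pset 0)
          (all 1 (always (equiv (atom bit1 0) (atom bit1 1)))))))))

theorem isCTLSentence_setSentence : setSentence.IsCTLSentence := by
  constructor
  · simp [setSentence, conj, TemporalInScope]
  · simp [setSentence, conj, branch, always, eventually, impl, equiv, freeVars]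

variable {V : Type u} (T : TransitionSystem SetProp V)

theorem ctlModel_setSentence_iff : CTLModel T setSentence ↔
    (∃ r, T.IsPath r ∧ r 0 = T.init ∧ fbt ∈ T.label (r 0)) ∧
    (∀ r, T.IsPath r → r 0 = T.init → ∀ j, fbt ∈ T.label (r j) →
      (∃ r', T.IsPath r' ∧ r' 0 = r j ∧
        fbt ∈ T.label (r' 1) ∧ bit1 ∈ T.label (r' 1) ∧ bit0 ∉ T.label (r' 1)) ∧
      (∃ r', T.IsPath r' ∧ r' 0 = r j ∧
        fbt ∈ T.label (r' 1) ∧ bit0 ∈ T.label (r' 1) ∧ bit1 ∉ T.label (r' 1))) ∧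
    (∀ r, T.IsPath r → r 0 = T.init → (∀ j, fbt ∈ T.label (r (j + 1))) →
      ∃ r', T.IsPath r' ∧ r' 0 = r 0 ∧ ∀ j, pset ∈ T.label (r' (j + 1)) ∧
        (bit1 ∈ T.label (r (j + 1)) ↔ bit1 ∈ T.label (r' (j + 1))) ∧
        (bit0 ∈ T.label (r (j + 1)) ↔ bit0 ∈ T.label (r' (j + 1)))) ∧
    (∀ r, T.IsPath r → r 0 = T.init → pset ∈ T.label (r 1) →
      ∀ r', T.IsPath r' → r' 0 = r 1 →
        ∀ j, bit1 ∈ T.label (r (j + 1)) ↔ bit1 ∈ T.label (r' j)) := by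
  simp [CTLModel, setSentence, branch, ctlSat_conj, ctlSat_impl, ctlSat_equiv, ctlSat_always,
    CTLSat, PathAssignment.assign, PathAssignment.suffix, PathAssignment.recent,
    PathAssignment.empty]

variable {T}

/-- Follow `r` up to position `j` and continue with `r'`. -/
theorem exists_isPath_splice {r r' : ℕ → V} (h : T.IsPath r) (h' : T.IsPath r') {j : ℕ}
    (hj : r' 0 = r j) :
    ∃ s, T.IsPath s ∧ s 0 = r 0 ∧ s (j + 1) = r' 1 := by
  refine ⟨fun n => if n ≤ j then r n else r' (n - j), fun n => ?_, by simp, by simp⟩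
  rcases lt_trichotomy n j with hn | rfl | hn
  · simpa [hn.le, Nat.succ_le_of_lt hn] using h n
  · simpa [hj] using h' 0
  · have := h' (n - j)
    rw [← Nat.sub_add_comm hn.le] at this
    simpa [hn.not_ge, (hn.trans (Nat.lt_succ_self n)).not_ge] using this

/-- Following the `fbt`-successors with the bits of the characteristic function of `A`, one
obtains an `fbt`-path for `A` and hence a `pset`-path for `A`. Its first vertex determines `A`,
because the `pset`-paths are deterministic. -/
theorem representsAllSets_of_ctlModel (h : CTLModel T setSentence) : RepresentsAllSets T := by
  obtain ⟨⟨r₀, hr₀, hr₀', hfbt⟩, hstep, hcopy, hdet⟩ := (ctlModel_setSentence_iff T).1 h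
  -- the `fbt`-vertices on infinite paths from the initial vertex; each has successors of this
  -- kind for both bits
  let R : V → Prop := fun v => ∃ r j, T.IsPath r ∧ r 0 = T.init ∧ r j = v ∧ fbt ∈ T.label v
  have hR : ∀ (v : V) (c : Prop), R v → ∃ w, T.edge v w ∧ R w ∧
      (bit1 ∈ T.label w ↔ c) ∧ (bit0 ∈ T.label w ↔ ¬ c) := by
    rintro v c ⟨r, j, hr, hr', rfl, hv⟩
    obtain ⟨h₁, h₀⟩ := hstep r hr hr' j hv
    have key : ∀ r', T.IsPath r' → r' 0 = r j → fbt ∈ T.label (r' 1) →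
        T.edge (r j) (r' 1) ∧ R (r' 1) := by
      intro r' hp h0 hl
      obtain ⟨s, hs, hs', hs''⟩ := exists_isPath_splice hr hp h0
      exact ⟨h0 ▸ hp 0, s, j + 1, hs, hs'.trans hr', hs'', hl⟩
    by_cases hc : c
    · obtain ⟨r', hp, h0, hl, h1, h2⟩ := h₁
      exact ⟨r' 1, (key r' hp h0 hl).1, (key r' hp h0 hl).2, by simp [h1, hc], by simp [h2, hc]⟩
    · obtain ⟨r', hp, h0, hl, h1, h2⟩ := h₀
      exact ⟨r' 1, (key r' hp h0 hl).1, (key r' hp h0 hl).2, by simp [h2, hc], by simp [h1, hc]⟩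
  have hinit : R T.init := ⟨r₀, 0, hr₀, hr₀', hr₀', hr₀' ▸ hfbt⟩
  have htree : ∀ A : Set ℕ, ∃ r, T.IsPath r ∧ r 0 = T.init ∧ ∀ i, fbt ∈ T.label (r (i + 1)) ∧
      (bit1 ∈ T.label (r (i + 1)) ↔ i ∈ A) ∧ (bit0 ∈ T.label (r (i + 1)) ↔ i ∉ A) := by
    intro A
    choose! next hedge hnext hone hzero using hR
    let s : ℕ → V := fun n => Nat.rec T.init (fun i v => next v (i ∈ A)) n
    have hs : ∀ n, R (s n) := fun n => by
      induction n with
      | zero => exact hinit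
      | succ n ih => exact hnext _ _ ih
    refine ⟨s, fun n => hedge _ _ (hs n), rfl, fun i => ⟨?_, hone _ _ (hs i), hzero _ _ (hs i)⟩⟩
    obtain ⟨_, _, _, _, _, hl⟩ := hs (i + 1)
    exact hl
  have hset : ∀ A : Set ℕ, ∃ r, T.IsPath r ∧ r 0 = T.init ∧ ∀ i, pset ∈ T.label (r (i + 1)) ∧
      (bit1 ∈ T.label (r (i + 1)) ↔ i ∈ A) ∧ (bit0 ∈ T.label (r (i + 1)) ↔ i ∉ A) := by
    intro A
    obtain ⟨r, hr, hr', hl⟩ := htree A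
    obtain ⟨r', hp, h0, h⟩ := hcopy r hr hr' fun j => (hl j).1
    exact ⟨r', hp, h0.trans hr', fun i => ⟨(h i).1, (h i).2.1.symm.trans (hl i).2.1,
      (h i).2.2.symm.trans (hl i).2.2⟩⟩
  choose r hr hr' hl using hset
  refine ⟨fun A n => r A (n + 1), fun A => ⟨fun n => hr A (n + 1), hr' A ▸ hr A 0, hl A⟩, ?_⟩
  intro A B hAB
  ext i
  rw [← (hl A i).2.1, ← (hl B i).2.1]
  exact hdet (r A) (hr A) (hr' A) (hl A 0).1 (fun n => r B (n + 1)) (fun n => hr B (n + 1))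
    hAB.symm i

end HyperFormula

theorem RepresentsAllSets.continuum_le {V : Type u} {T : TransitionSystem SetProp V}
    (h : RepresentsAllSets T) : Cardinal.continuum.{u} ≤ Cardinal.mk V := by
  obtain ⟨r, _, hr⟩ := h
  simpa [Cardinal.mk_set] using Cardinal.mk_le_of_injective (α := ULift.{u} (Set ℕ))
    (f := fun A => r A.down 0) fun A B hAB => ULift.down_injective (hr hAB)

/-! ### Translating arithmetic into HyperLTL-like formulas -/

/-- The propositions `fbt`, `pset`, `bit0`, `bit1` as natural numbers. -/
def setNum : SetProp → ℕ
  | SetProp.fbt => 0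
  | SetProp.pset => 1
  | SetProp.bit0 => 2
  | SetProp.bit1 => 3

/-- The propositions `arg1`, `arg2`, `res`, `add`, `mult` as natural numbers. -/
def opNum : OpProp → ℕ
  | OpProp.arg1 => 4
  | OpProp.arg2 => 5
  | OpProp.res => 6
  | OpProp.add => 7
  | OpProp.mult => 8

/-- The proposition that marks the members of the third-order variable `X`. -/
def famNum (X : ℕ) : ℕ := X + 9

/-- The proposition that holds exactly at the elements of the represented set. -/
abbrev bit : ℕ := setNum SetProp.bit1

/-- The trace variable for the number variable `x`. The variable `0` is used for traces that are
needed only locally. -/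
def numVar (x : ℕ) : ℕ := 3 * x + 1

/-- The trace variable for the set variable `Y`. -/
def setVar (Y : ℕ) : ℕ := 3 * Y + 2

/-- The trace variable for the value of the term with Gödel number `c`. Different subterms thus
have different variables without any bookkeeping of fresh variables. -/
def resVar (c : ℕ) : ℕ := 3 * c + 3

namespace HyperFormula

/-- The numbers represented by `p`, `q`, `r` are the arguments and the result of the
operation `o`. -/
def opRel (o : OpProp) (p q r : ℕ) : HyperFormula ℕ :=
  ex 0 (conj (atom (opNum o) 0) (conj (meet (opNum .arg1) 0 bit p)
    (conj (meet (opNum .arg2) 0 bit q) (meet (opNum .res) 0 bit r))))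

/-- Existential quantification of `p` over the numbers that satisfy `χ`. -/
def bindNum (p : ℕ) (χ φ : HyperFormula ℕ) : HyperFormula ℕ :=
  ex p (conj (once bit p) (conj χ φ))

end HyperFormula

open HyperFormula in
/-- The value of the term is the number represented by the variable `resVar t.code`. -/
def ArithTerm.isValue : ArithTerm → HyperFormula ℕ
  | .zero => atom bit (resVar 0)
  | .one => next (atom bit (resVar 1))
  | .var x => meet bit (numVar x) bit (resVar (ArithTerm.code (.var x)))
  | .add s t => bindNum (resVar s.code) (isValue s) (bindNum (resVar t.code) (isValue t)
      (opRel .add (resVar s.code) (resVar t.code) (resVar (ArithTerm.code (.add s t)))))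
  | .mul s t => bindNum (resVar s.code) (isValue s) (bindNum (resVar t.code) (isValue t)
      (opRel .mult (resVar s.code) (resVar t.code) (resVar (ArithTerm.code (.mul s t)))))

/-- Bind the value of `t` to the variable `resVar t.code`. -/
def ArithTerm.bindValue (t : ArithTerm) (φ : HyperFormula ℕ) : HyperFormula ℕ :=
  HyperFormula.bindNum (resVar t.code) t.isValue φ

open HyperFormula in
/-- The translation of second-order arithmetic with third-order parameters. A set belongs to the
family `X` if some trace that represents the set carries `famNum X` at its first position. -/
def ArithFormula.toHyper : ArithFormula → HyperFormula ℕ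
  | .eq s t => s.bindValue (t.bindValue (meet bit (resVar s.code) bit (resVar t.code)))
  | .lt s t => s.bindValue (t.bindValue
      (eventually (conj (atom bit (resVar s.code)) (next (eventually (atom bit (resVar t.code)))))))
  | .memSet t Y => t.bindValue (meet bit (resVar t.code) bit (setVar Y))
  | .memFam Y X => ex 0 (conj (atom (famNum X) 0)
      (always (equiv (atom bit 0) (atom bit (setVar Y)))))
  | .neg φ => .neg (toHyper φ)
  | .or φ ψ => .or (toHyper φ) (toHyper ψ)
  | .exNum x φ => ex (numVar x) (conj (once bit (numVar x)) (toHyper φ))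
  | .exSet Y φ => ex (setVar Y) (toHyper φ)

/-- The set of traces provides the graphs of addition and multiplication and all sets of natural
numbers. -/
structure IsArithmetical (S : Set (ℕ → Set ℕ)) : Prop where
  ops : {t | t ∈ (fun t n => opNum ⁻¹' t n) '' S ∧ IsOpTrace t} = opTraces
  sets : ∀ A : Set ℕ, ∃ t ∈ S, ∀ k, bit ∈ t k ↔ k ∈ A

theorem IsArithmetical.num {S : Set (ℕ → Set ℕ)} (hS : IsArithmetical S) (n : ℕ) :
    ∃ t ∈ S, ∀ k, bit ∈ t k ↔ k = n :=
  hS.sets {n}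

/-- The interpretation of the third-order variables given by a set of traces. -/
def famOf (S : Set (ℕ → Set ℕ)) (X : ℕ) : Set (Set ℕ) :=
  {A | ∃ t ∈ S, famNum X ∈ t 0 ∧ ∀ k, bit ∈ t k ↔ k ∈ A}

namespace HyperFormula

/-- The trace assigned to `p` represents the number `n`. -/
def HasNum (P : ℕ → Option (ℕ → Set ℕ)) (p n : ℕ) : Prop := ∀ k, At P p bit k ↔ k = n

/-- The trace assigned to `p` represents the set `A`. -/
def HasSet (P : ℕ → Option (ℕ → Set ℕ)) (p : ℕ) (A : Set ℕ) : Prop := ∀ k, At P p bit k ↔ k ∈ A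

variable {S : Set (ℕ → Set ℕ)} {P Q : ℕ → Option (ℕ → Set ℕ)}

theorem HasNum.congr {p n : ℕ} (h : HasNum P p n) (hQ : Q p = P p) : HasNum Q p n := by
  simpa [HasNum, At, hQ] using h

theorem HasSet.congr {p : ℕ} {A : Set ℕ} (h : HasSet P p A) (hQ : Q p = P p) : HasSet Q p A := by
  simpa [HasSet, At, hQ] using h

theorem hasNum_update {p n : ℕ} {t : ℕ → Set ℕ} :
    HasNum (Function.update P p (some t)) p n ↔ ∀ k, bit ∈ t k ↔ k = n := by
  simp [HasNum, at_update_self]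

theorem hasSet_update {p : ℕ} {A : Set ℕ} {t : ℕ → Set ℕ} :
    HasSet (Function.update P p (some t)) p A ↔ ∀ k, bit ∈ t k ↔ k ∈ A := by
  simp [HasSet, at_update_self]

theorem ltlSat_meet_num {p m q n : ℕ} (hp : HasNum P p m) (hq : HasNum P q n) :
    LTLSat S (meet bit p bit q) P ↔ m = n := by
  simp [ltlSat_meet, hp _, hq _]

theorem ltlSat_opRel (hS : IsArithmetical S) {o : OpProp} {b : Bool}
    (ho : o = if b then .mult else .add) {p q r a₁ a₂ a₃ : ℕ} (hp : HasNum P p a₁)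
    (hq : HasNum P q a₂) (hr : HasNum P r a₃) (hp' : p ≠ 0) (hq' : q ≠ 0) (hr' : r ≠ 0) :
    LTLSat S (opRel o p q r) P ↔ (if b then a₁ * a₂ else a₁ + a₂) = a₃ := by
  simp only [opRel, ltlSat_ex, ltlSat_conj, ltlSat_atom, ltlSat_meet, at_update_self,
    at_update_of_ne _ hp', at_update_of_ne _ hq', at_update_of_ne _ hr', hp _, hq _, hr _,
    exists_eq_right]
  constructor
  · rintro ⟨t, ht, h₀, h₁, h₂, h₃⟩
    have hop : IsOpTrace (fun n => opNum ⁻¹' t n) := by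
      subst ho
      cases b
      · exact Or.inl h₀
      · exact Or.inr h₀
    have hmem := (Set.ext_iff.1 hS.ops _).1 ⟨⟨t, ht, rfl⟩, hop⟩
    obtain ⟨b', n₁, n₂, heq⟩ := mem_opTraces_iff.1 hmem
    have hiff : ∀ o k, opNum o ∈ t k ↔
        o ∈ opTrace b' n₁ n₂ (if b' then n₁ * n₂ else n₁ + n₂) k := fun o k => by
      rw [← heq]; rfl
    rw [hiff] at h₀ h₁ h₂ h₃
    obtain rfl : b = b' := by subst ho; cases b <;> simp_all
    rw [arg1_mem_opTrace] at h₁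
    rw [arg2_mem_opTrace] at h₂
    rw [res_mem_opTrace] at h₃
    rw [h₁, h₂, h₃]
  · rintro rfl
    obtain ⟨⟨t, ht, heq⟩, -⟩ := (Set.ext_iff.1 hS.ops
      (opTrace b a₁ a₂ (if b then a₁ * a₂ else a₁ + a₂))).2
        ((opTrace_mem_opTraces_iff ..).2 rfl)
    have hiff : ∀ o k, opNum o ∈ t k ↔
        o ∈ opTrace b a₁ a₂ (if b then a₁ * a₂ else a₁ + a₂) k := fun o k => by
      rw [← heq]; rfl
    refine ⟨t, ht, ?_, (hiff _ _).2 rfl, (hiff _ _).2 rfl, (hiff _ _).2 rfl⟩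
    rw [hiff]
    subst ho
    cases b <;> simp

/-- If `χ` says that `p` represents the number `n`, then `φ` is evaluated with this number. -/
theorem ltlSat_bindNum (hS : IsArithmetical S) {p n : ℕ} {χ φ : HyperFormula ℕ} {C : Prop}
    (hχ : ∀ Q m, (∀ q ≠ p, Q q = P q) → HasNum Q p m → (LTLSat S χ Q ↔ n = m))
    (hφ : ∀ Q, (∀ q ≠ p, Q q = P q) → HasNum Q p n → (LTLSat S φ Q ↔ C)) :
    LTLSat S (bindNum p χ φ) P ↔ C := by
  have hoff : ∀ t, ∀ q ≠ p, Function.update P p (some t) q = P q := fun t q hq => by simp [hq]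
  simp only [bindNum, ltlSat_ex, ltlSat_conj, ltlSat_once]
  constructor
  · rintro ⟨t, -, ⟨m, hm⟩, h₁, h₂⟩
    obtain rfl := (hχ _ m (hoff t) hm).1 h₁
    exact (hφ _ (hoff t) hm).1 h₂
  · intro hC
    obtain ⟨t, ht, hk⟩ := hS.num n
    have hn := (hasNum_update (P := P) (p := p)).2 hk
    exact ⟨t, ht, ⟨n, hn⟩, (hχ _ n (hoff t) hn).2 rfl, (hφ _ (hoff t) hn).2 hC⟩

theorem numVar_ne_resVar (x c : ℕ) : numVar x ≠ resVar c := by simp only [numVar, resVar]; omega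

theorem setVar_ne_resVar (Y c : ℕ) : setVar Y ≠ resVar c := by simp only [setVar, resVar]; omega

theorem numVar_ne_setVar (x Y : ℕ) : numVar x ≠ setVar Y := by simp only [numVar, setVar]; omega

theorem resVar_ne {c d : ℕ} (h : c ≠ d) : resVar c ≠ resVar d := by simp only [resVar]; omega

/-- The two values are bound one after the other; the case of equal terms, where the second
quantifier rebinds the variable of the first, is included. -/
theorem ltlSat_bindNum_bindNum (hS : IsArithmetical S) {s t : ArithTerm} {m n : ℕ}
    {χ₁ χ₂ φ : HyperFormula ℕ} {C : Prop} (hmn : s = t → m = n)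
    (hχ₁ : ∀ Q k, (∀ x, Q (numVar x) = P (numVar x)) → HasNum Q (resVar s.code) k →
      (LTLSat S χ₁ Q ↔ m = k))
    (hχ₂ : ∀ Q k, (∀ x, Q (numVar x) = P (numVar x)) → HasNum Q (resVar t.code) k →
      (LTLSat S χ₂ Q ↔ n = k))
    (hφ : ∀ Q, (∀ q, q ≠ resVar s.code → q ≠ resVar t.code → Q q = P q) →
      HasNum Q (resVar s.code) m → HasNum Q (resVar t.code) n → (LTLSat S φ Q ↔ C)) :
    LTLSat S (bindNum (resVar s.code) χ₁ (bindNum (resVar t.code) χ₂ φ)) P ↔ C := by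
  refine ltlSat_bindNum hS (n := m)
    (fun Q k hQ hk => hχ₁ Q k (fun x => hQ _ (numVar_ne_resVar _ _)) hk) fun Q hQ hm => ?_
  refine ltlSat_bindNum hS (n := n) (fun R k hR hk => hχ₂ R k (fun x => ?_) hk)
    fun R hR hn => hφ R (fun q h₁ h₂ => (hR q h₂).trans (hQ q h₁)) ?_ hn
  · rw [hR _ (numVar_ne_resVar _ _), hQ _ (numVar_ne_resVar _ _)]
  · by_cases h : s = t
    · subst h
      rwa [hmn rfl]
    · exact hm.congr (hR _ (resVar_ne fun hc => h (ArithTerm.code_injective hc)))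

theorem ltlSat_isValue (hS : IsArithmetical S) (e : ℕ → ℕ) (t : ArithTerm) {n : ℕ}
    (he : ∀ x ∈ t.vars, HasNum P (numVar x) (e x)) (hn : HasNum P (resVar t.code) n) :
    LTLSat S t.isValue P ↔ t.eval e = n := by
  have hne : ∀ c, resVar c ≠ 0 := fun c => Nat.succ_ne_zero _
  induction t generalizing P n with
  | zero => exact hn 0
  | one =>
    rw [ArithTerm.isValue, ltlSat_next, ltlSat_atom, at_shift]
    exact hn 1
  | var x => exact ltlSat_meet_num (he x rfl) hn
  | add s t ihs iht =>
    have hs : s.code < (s.add t).code := by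
      have := Nat.left_le_pair s.code t.code; simp only [ArithTerm.code]; omega
    have ht : t.code < (s.add t).code := by
      have := Nat.right_le_pair s.code t.code; simp only [ArithTerm.code]; omega
    refine ltlSat_bindNum_bindNum hS (m := s.eval e) (n := t.eval e) (by rintro rfl; rfl)
      (fun Q k hQ hk => ihs (fun x hx => (he x (.inl hx)).congr (hQ x)) hk)
      (fun Q k hQ hk => iht (fun x hx => (he x (.inr hx)).congr (hQ x)) hk)
      fun Q hQ h₁ h₂ => ?_
    exact ltlSat_opRel hS (b := false) rfl h₁ h₂
      (hn.congr (hQ _ (resVar_ne hs.ne') (resVar_ne ht.ne'))) (hne _) (hne _) (hne _)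
  | mul s t ihs iht =>
    have hs : s.code < (s.mul t).code := by
      have := Nat.left_le_pair s.code t.code; simp only [ArithTerm.code]; omega
    have ht : t.code < (s.mul t).code := by
      have := Nat.right_le_pair s.code t.code; simp only [ArithTerm.code]; omega
    refine ltlSat_bindNum_bindNum hS (m := s.eval e) (n := t.eval e) (by rintro rfl; rfl)
      (fun Q k hQ hk => ihs (fun x hx => (he x (.inl hx)).congr (hQ x)) hk)
      (fun Q k hQ hk => iht (fun x hx => (he x (.inr hx)).congr (hQ x)) hk)
      fun Q hQ h₁ h₂ => ?_
    exact ltlSat_opRel hS (b := true) rfl h₁ h₂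
      (hn.congr (hQ _ (resVar_ne hs.ne') (resVar_ne ht.ne'))) (hne _) (hne _) (hne _)

/-- Over an arithmetical set of traces the translation is correct, the third-order variables
being interpreted by `famOf`. Only the free variables of the formula have to be assigned. -/
theorem ltlSat_toHyper (hS : IsArithmetical S) (ψ : ArithFormula) (e : ℕ → ℕ) (E : ℕ → Set ℕ)
    (he : ∀ x ∈ ψ.freeNum, HasNum P (numVar x) (e x))
    (hE : ∀ Y ∈ ψ.freeSet, HasSet P (setVar Y) (E Y)) :
    LTLSat S ψ.toHyper P ↔ ψ.Holds e E (famOf S) := by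
  induction ψ generalizing P e E with
  | eq s t =>
    refine ltlSat_bindNum_bindNum hS (m := s.eval e) (n := t.eval e) (by rintro rfl; rfl)
      (fun Q k hQ hk => ltlSat_isValue hS e s (fun x hx => (he x (.inl hx)).congr (hQ x)) hk)
      (fun Q k hQ hk => ltlSat_isValue hS e t (fun x hx => (he x (.inr hx)).congr (hQ x)) hk)
      fun Q hQ h₁ h₂ => ltlSat_meet_num h₁ h₂
  | lt s t =>
    refine ltlSat_bindNum_bindNum hS (m := s.eval e) (n := t.eval e) (by rintro rfl; rfl)
      (fun Q k hQ hk => ltlSat_isValue hS e s (fun x hx => (he x (.inl hx)).congr (hQ x)) hk)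
      (fun Q k hQ hk => ltlSat_isValue hS e t (fun x hx => (he x (.inr hx)).congr (hQ x)) hk)
      fun Q hQ h₁ h₂ => ?_
    simp only [ltlSat_eventually, ltlSat_conj, ltlSat_next, ltlSat_atom, at_shift, h₁ _, h₂ _,
      zero_add, exists_eq_left]
    rw [ArithFormula.Holds, Nat.lt_iff_add_one_le, le_iff_exists_add]
    exact exists_congr fun k => by omega
  | memSet t Y =>
    refine ltlSat_bindNum hS (n := t.eval e) (fun Q k hQ hk => ltlSat_isValue hS e t
      (fun x hx => (he x hx).congr (hQ _ (numVar_ne_resVar _ _))) hk) fun Q hQ hn => ?_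
    have hY := (hE Y rfl).congr (hQ _ (setVar_ne_resVar _ _))
    simp only [ltlSat_meet, hn _, hY _, exists_eq_left]
    rfl
  | memFam Y X =>
    have hY := hE Y rfl
    have hne : setVar Y ≠ 0 := Nat.succ_ne_zero _
    simp only [ArithFormula.toHyper, ltlSat_ex, ltlSat_conj, ltlSat_always, ltlSat_equiv,
      ltlSat_atom, at_shift, at_update_self, at_update_of_ne _ hne, hY _, zero_add]
    rfl
  | neg φ ih => exact not_congr (ih e E he hE)
  | or φ ψ ih₁ ih₂ =>
    exact or_congr (ih₁ e E (fun x hx => he x (.inl hx)) fun Y hY => hE Y (.inl hY))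
      (ih₂ e E (fun x hx => he x (.inr hx)) fun Y hY => hE Y (.inr hY))
  | exNum x φ ih =>
    simp only [ArithFormula.toHyper, ltlSat_ex, ltlSat_conj, ltlSat_once, ArithFormula.Holds]
    have key : ∀ t n, HasNum (Function.update P (numVar x) (some t)) (numVar x) n →
        (LTLSat S φ.toHyper (Function.update P (numVar x) (some t)) ↔
          φ.Holds (Function.update e x n) E (famOf S)) := by
      intro t n hn
      refine ih _ _ (fun y hy => ?_) fun Y hY => (hE Y hY).congr ?_
      · by_cases hxy : y = x
        · subst hxy
          simpa using hn
        · have hne : numVar y ≠ numVar x := by simp only [numVar]; omega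
          rw [Function.update_of_ne hxy]
          exact (he y ⟨hy, hxy⟩).congr (Function.update_of_ne hne ..)
      · exact Function.update_of_ne (numVar_ne_setVar _ _).symm ..
    constructor
    · rintro ⟨t, -, ⟨n, hn⟩, h⟩
      exact ⟨n, (key t n hn).1 h⟩
    · rintro ⟨n, h⟩
      obtain ⟨t, ht, hk⟩ := hS.num n
      have hn := (hasNum_update (P := P) (p := numVar x)).2 hk
      exact ⟨t, ht, ⟨n, hn⟩, (key t n hn).2 h⟩
  | exSet Z φ ih =>
    simp only [ArithFormula.toHyper, ltlSat_ex, ArithFormula.Holds]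
    have key : ∀ t A, HasSet (Function.update P (setVar Z) (some t)) (setVar Z) A →
        (LTLSat S φ.toHyper (Function.update P (setVar Z) (some t)) ↔
          φ.Holds e (Function.update E Z A) (famOf S)) := by
      intro t A hA
      refine ih _ _ (fun x hx => (he x hx).congr ?_) fun Y hY => ?_
      · exact Function.update_of_ne (numVar_ne_setVar _ _) ..
      · by_cases hYZ : Y = Z
        · subst hYZ
          simpa using hA
        · have hne : setVar Y ≠ setVar Z := by simp only [setVar]; omega
          rw [Function.update_of_ne hYZ]
          exact (hE Y ⟨hY, hYZ⟩).congr (Function.update_of_ne hne ..)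
    constructor
    · rintro ⟨t, -, h⟩
      exact ⟨{k | bit ∈ t k}, (key t _ (hasSet_update.2 fun k => Iff.rfl)).1 h⟩
    · rintro ⟨A, h⟩
      obtain ⟨t, ht, hk⟩ := hS.sets A
      exact ⟨t, ht, (key t A (hasSet_update.2 hk)).2 h⟩

/-! ### Shape and free variables of the translation -/

theorem flat_isValue (t : ArithTerm) : t.isValue.Flat := by
  induction t <;>
    simp_all [ArithTerm.isValue, bindNum, opRel, once, meet, always, eventually, conj, Flat,
      QuantifierFree]

theorem flat_toHyper (ψ : ArithFormula) : ψ.toHyper.Flat := by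
  induction ψ <;>
    simp_all [ArithFormula.toHyper, ArithTerm.bindValue, flat_isValue, bindNum, once, meet, always,
      eventually, equiv, impl, conj, Flat, QuantifierFree]

theorem freeVars_bindNum (p : ℕ) (χ φ : HyperFormula ℕ) :
    (bindNum p χ φ).freeVars = (χ.freeVars ∪ φ.freeVars) \ {p} := by
  ext q
  simp [bindNum, once, always, eventually, conj, freeVars]

theorem freeVars_opRel {o : OpProp} {p q r : ℕ} : (opRel o p q r).freeVars ⊆ {p, q, r} := by
  intro n
  simp [opRel, meet, eventually, conj, freeVars]
  tauto

theorem freeVars_isValue (t : ArithTerm) :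
    t.isValue.freeVars ⊆ insert (resVar t.code) (numVar '' t.vars) := by
  have key : ∀ {A B C D E : Set ℕ} {p q r : ℕ}, A ⊆ insert p D → B ⊆ insert q E → C ⊆ {p, q, r} →
      (A ∪ ((B ∪ C) \ {q})) \ {p} ⊆ insert r (D ∪ E) := by
    intro A B C D E p q r hA hB hC n
    have h₁ := @hA n
    have h₂ := @hB n
    have h₃ := @hC n
    simp only [Set.mem_sdiff, Set.mem_union, Set.mem_insert_iff, Set.mem_singleton_iff] at *
    tauto
  induction t with
  | zero => simp [ArithTerm.isValue, freeVars, ArithTerm.code]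
  | one => simp [ArithTerm.isValue, freeVars, ArithTerm.code]
  | var x =>
    simp [ArithTerm.isValue, meet, eventually, conj, freeVars, ArithTerm.vars]
  | add s t ihs iht =>
    rw [ArithTerm.isValue, freeVars_bindNum, freeVars_bindNum, ArithTerm.vars, Set.image_union]
    exact key ihs iht freeVars_opRel
  | mul s t ihs iht =>
    rw [ArithTerm.isValue, freeVars_bindNum, freeVars_bindNum, ArithTerm.vars, Set.image_union]
    exact key ihs iht freeVars_opRel

theorem freeVars_bindValue (t : ArithTerm) (φ : HyperFormula ℕ) :
    (t.bindValue φ).freeVars ⊆ numVar '' t.vars ∪ φ.freeVars \ {resVar t.code} := by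
  rw [ArithTerm.bindValue, freeVars_bindNum, Set.union_sdiff_distrib]
  refine Set.union_subset_union_left _ fun n hn => ?_
  exact (Set.mem_insert_iff.1 (freeVars_isValue t hn.1)).resolve_left hn.2

theorem freeVars_toHyper (ψ : ArithFormula) :
    ψ.toHyper.freeVars ⊆ numVar '' ψ.freeNum ∪ setVar '' ψ.freeSet := by
  have key : ∀ {s t : ArithTerm} {φ : HyperFormula ℕ},
      φ.freeVars ⊆ {resVar s.code, resVar t.code} →
      (s.bindValue (t.bindValue φ)).freeVars ⊆ numVar '' (s.vars ∪ t.vars) := by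
    intro s t φ hφ n hn
    rw [Set.image_union]
    rcases freeVars_bindValue _ _ hn with h | ⟨h, hs⟩
    · exact .inl h
    · rcases freeVars_bindValue _ _ h with h | ⟨h, ht⟩
      · exact .inr h
      · rcases hφ h with h | h
        · exact absurd h hs
        · exact absurd h ht
  induction ψ with
  | eq s t =>
    refine (key ?_).trans Set.subset_union_left
    simp [meet, eventually, conj, freeVars, Set.pair_comm]
  | lt s t =>
    refine (key ?_).trans Set.subset_union_left
    simp [eventually, conj, freeVars, Set.pair_comm]
  | memSet t Y =>
    refine (freeVars_bindValue _ _).trans (Set.union_subset_union_right _ ?_)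
    intro n
    simp [meet, eventually, conj, freeVars, ArithFormula.freeSet]
    tauto
  | memFam Y X =>
    intro n
    simp [ArithFormula.toHyper, always, equiv, impl, eventually, conj, freeVars,
      ArithFormula.freeSet, ArithFormula.freeNum]
    tauto
  | neg φ ih => exact ih
  | or φ ψ ih₁ ih₂ =>
    simp only [ArithFormula.toHyper, ArithFormula.freeNum, ArithFormula.freeSet, freeVars,
      Set.image_union]
    rintro n (h | h)
    · exact (ih₁ h).imp .inl .inl
    · exact (ih₂ h).imp .inr .inr
  | exNum x φ ih =>
    rintro n ⟨h, hn⟩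
    have h' : n ∈ φ.toHyper.freeVars := by
      have : n ≠ numVar x := hn
      simpa [once, always, eventually, conj, freeVars, this] using h
    rcases ih h' with ⟨y, hy, rfl⟩ | h
    · exact .inl ⟨y, ⟨hy, fun hxy => hn (congrArg numVar hxy)⟩, rfl⟩
    · exact .inr h
  | exSet Z φ ih =>
    rintro n ⟨h, hn⟩
    rcases ih h with h | ⟨Y, hY, rfl⟩
    · exact .inl h
    · exact .inr ⟨Y, ⟨hY, fun hYZ => hn (congrArg setVar hYZ)⟩, rfl⟩

end HyperFormula

/-! ### The sentence for a formula of third-order arithmetic -/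

open HyperFormula in
/-- Satisfiable if and only if `ψ` is true for some interpretation of the third-order variables
(and `ψ` has no other free variables). The vacuous quantifier provides a scope for the temporal
operators. -/
def ArithFormula.toSentence (ψ : ArithFormula) : HyperFormula ℕ :=
  conj (setSentence.map setNum) (delay (ex 0 (conj (opSentence.map opNum) ψ.toHyper)))

namespace HyperFormula

variable {ψ : ArithFormula}

theorem isCTLSentence_toSentence (hnum : ψ.freeNum = ∅) (hset : ψ.freeSet = ∅) :
    ψ.toSentence.IsCTLSentence := by
  obtain ⟨h₁, h₂⟩ := (isCTLSentence_map setNum _).2 isCTLSentence_setSentence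
  have h₃ : ψ.toHyper.freeVars = ∅ := by
    simpa [hnum, hset] using freeVars_toHyper ψ
  have h₄ : opSentence.freeVars = ∅ := freeVars_opPrefix freeVars_opMatrix
  constructor
  · simpa [ArithFormula.toSentence, conj, TemporalInScope, delay] using h₁
  · simp [ArithFormula.toSentence, conj, freeVars, freeVars_delay, freeVars_map, h₃, h₄,
      (freeVars_map setNum setSentence).symm.trans h₂]

theorem ctlModel_toSentence_iff {V : Type u} (T : TransitionSystem ℕ V) :
    CTLModel T ψ.toSentence ↔ CTLModel (T.comap setNum) setSentence ∧
      ∃ t ∈ T.traces, {t | t ∈ (fun t n => opNum ⁻¹' t n) '' T.traces ∧ IsOpTrace t} = opTraces ∧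
        LTLSat T.traces ψ.toHyper (Function.update (fun _ => none) 0 (some t)) := by
  have hflat : (ex 0 (conj (opSentence.map opNum) ψ.toHyper)).Flat :=
    ⟨(prenex_opPrefix quantifierFree_opMatrix).flat.map opNum, flat_toHyper ψ⟩
  rw [CTLModel, ArithFormula.toSentence, ctlSat_conj, ctlSat_map, ctlSat_delay T hflat _ rfl,
    ltlSat_ex]
  simp only [ltlSat_conj, ltlSat_map, ltlSat_opSentence_iff]
  rfl

theorem isArithmetical_traces {V : Type u} {T : TransitionSystem ℕ V}
    (hset : CTLModel (T.comap setNum) setSentence)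
    (hop : {t | t ∈ (fun t n => opNum ⁻¹' t n) '' T.traces ∧ IsOpTrace t} = opTraces) :
    IsArithmetical T.traces := by
  refine ⟨hop, fun A => ?_⟩
  obtain ⟨r, hr, -⟩ := representsAllSets_of_ctlModel hset
  obtain ⟨hpath, hinit, hl⟩ := hr A
  refine ⟨fun n => T.label (r A n), ⟨fun n => Nat.casesOn n T.init (r A), ?_, rfl, rfl⟩,
    fun k => (hl k).2.1⟩
  rintro (_ | n)
  · exact hinit
  · exact hpath n

/-- Every model of the sentence yields an interpretation of the third-order variables under
which `ψ` is true. -/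
theorem holds_of_ctlModel (hnum : ψ.freeNum = ∅) (hset : ψ.freeSet = ∅) {V : Type u}
    {T : TransitionSystem ℕ V} (h : CTLModel T ψ.toSentence) (e : ℕ → ℕ) (E : ℕ → Set ℕ) :
    ψ.Holds e E (famOf T.traces) := by
  obtain ⟨h₁, t, -, h₂, h₃⟩ := (ctlModel_toSentence_iff T).1 h
  exact (ltlSat_toHyper (isArithmetical_traces h₁ h₂) ψ e E (by simp [hnum])
    (by simp [hset])).1 h₃

end HyperFormula

/-! ### The canonical model -/

/-- Vertices of the canonical model: a root, two vertices that generate all sequences of bits, and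
a vertex for each trace. -/
inductive ModelVertex : Type u
  | root
  | tree (b : Bool)
  | trace (t : ℕ → Set ℕ)

namespace ModelVertex

/-- The root has edges to the bits and to the traces in `S`; from a trace one can only go to its
suffix. -/
def system (S : Set (ℕ → Set ℕ)) : TransitionSystem ℕ ModelVertex.{u} where
  edge
    | root, tree _ => True
    | root, trace t => t ∈ S
    | tree _, tree _ => True
    | trace t, trace t' => t' = fun n => t (n + 1)
    | _, _ => False
  init := root
  label
    | root => {setNum .fbt}
    | tree b => {setNum .fbt, setNum (if b then .bit1 else .bit0)}
    | trace t => t 0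

variable {S : Set (ℕ → Set ℕ)} {r : ℕ → ModelVertex.{u}}

theorem isTotal_system : (system.{u} S).IsTotal
  | root => ⟨tree true, trivial⟩
  | tree _ => ⟨tree true, trivial⟩
  | trace _ => ⟨trace _, rfl⟩

theorem eq_tree_of_isPath (h : (system S).IsPath r) {b : Bool} (h₀ : r 0 = tree b) (n : ℕ) :
    ∃ b, r n = tree b := by
  induction n with
  | zero => exact ⟨b, h₀⟩
  | succ n ih =>
    obtain ⟨c, hc⟩ := ih
    have := h n
    rw [hc] at this
    cases hr : r (n + 1) with
    | root => simp [hr, system] at this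
    | tree b => exact ⟨b, rfl⟩
    | trace t => simp [hr, system] at this

theorem eq_trace_of_isPath (h : (system S).IsPath r) {t : ℕ → Set ℕ} (h₀ : r 0 = trace t)
    (n : ℕ) : r n = trace fun k => t (k + n) := by
  induction n with
  | zero => exact h₀
  | succ n ih =>
    have := h n
    rw [ih] at this
    cases hr : r (n + 1) with
    | root => simp [hr, system] at this
    | tree b => simp [hr, system] at this
    | trace t' =>
      rw [hr] at this
      change t' = _ at this
      simp [this, add_assoc, add_comm 1]

theorem isPath_trace {t : ℕ → Set ℕ} (ht : t ∈ S) :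
    (system.{u} S).IsPath (fun n => Nat.casesOn n root fun n => trace fun k => t (k + n)) := by
  rintro (_ | n)
  · exact ht
  · simp [system, add_assoc, add_comm 1]

theorem isPath_tree (s : ℕ → Bool) :
    (system.{u} S).IsPath (fun n => Nat.casesOn n root fun n => tree (s n)) := by
  rintro (_ | n) <;> trivial

/-- A path from the root either stays in the vertices for the bits or follows a trace in `S`. -/
theorem isPath_root (h : (system S).IsPath r) (h₀ : r 0 = root) :
    (∀ n, ∃ b, r (n + 1) = tree b) ∨ ∃ t ∈ S, ∀ n, r (n + 1) = trace fun k => t (k + n) := by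
  have h' : (system S).IsPath fun n => r (n + 1) := fun n => h (n + 1)
  have := h 0
  rw [h₀] at this
  cases hr : r (0 + 1) with
  | root => simp [hr, system] at this
  | tree b => exact .inl (eq_tree_of_isPath h' hr)
  | trace t =>
    rw [hr] at this
    exact .inr ⟨t, this, eq_trace_of_isPath h' hr⟩

theorem mem_traces_iff {t : ℕ → Set ℕ} : t ∈ (system.{u} S).traces ↔
    t ∈ S ∨ ∃ s : ℕ → Bool, t = fun n => (system.{u} S).label (tree (s n)) := by
  constructor
  · rintro ⟨r, hr, h₀, rfl⟩
    rcases isPath_root hr h₀ with h | ⟨t, ht, h⟩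
    · choose s hs using h
      exact .inr ⟨s, by simp [hs]⟩
    · refine .inl ?_
      simpa [h, system] using ht
  · rintro (ht | ⟨s, rfl⟩)
    · exact ⟨_, isPath_trace ht, rfl, by simp [system]⟩
    · exact ⟨_, isPath_tree s, rfl, rfl⟩

/-- The trace that represents the set `A` and the families that contain `A`. -/
def setTrace (F : ℕ → Set (Set ℕ)) (A : Set ℕ) : ℕ → Set ℕ := fun n =>
  {a | a = setNum .pset ∨ a = setNum .bit1 ∧ n ∈ A ∨ a = setNum .bit0 ∧ n ∉ A ∨
    n = 0 ∧ ∃ X, a = famNum X ∧ A ∈ F X}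

/-- The traces of the canonical model for the interpretation `F` of the third-order variables. -/
def modelTraces (F : ℕ → Set (Set ℕ)) : Set (ℕ → Set ℕ) :=
  Set.range (setTrace F) ∪ (fun t n => opNum '' t n) '' opTraces

variable (F : ℕ → Set (Set ℕ))

theorem opNum_injective : Function.Injective opNum := by
  intro a b h
  cases a <;> cases b <;> simp_all [opNum]

theorem bit1_mem_setTrace (A : Set ℕ) (n : ℕ) : bit ∈ setTrace F A n ↔ n ∈ A := by
  simp [setTrace, setNum, famNum]

theorem bit0_mem_setTrace (A : Set ℕ) (n : ℕ) : setNum .bit0 ∈ setTrace F A n ↔ n ∉ A := by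
  simp [setTrace, setNum, famNum]

theorem pset_mem_setTrace (A : Set ℕ) (n : ℕ) : setNum .pset ∈ setTrace F A n := Or.inl rfl

theorem fbt_notMem_modelTraces {t : ℕ → Set ℕ} (ht : t ∈ modelTraces F) (n : ℕ) :
    setNum .fbt ∉ t n := by
  rcases ht with ⟨A, rfl⟩ | ⟨t, -, rfl⟩
  · simp [setTrace, setNum, famNum]
  · rintro ⟨o, -, ho⟩
    cases o <;> simp [opNum, setNum] at ho

theorem ctlModel_setSentence :
    HyperFormula.CTLModel ((system.{u} (modelTraces F)).comap setNum)
      HyperFormula.setSentence := by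
  rw [HyperFormula.ctlModel_setSentence_iff]
  have htree : ∀ b s, (∀ t, s ≠ trace t) →
      ∃ r, (system.{u} (modelTraces F)).IsPath r ∧ r 0 = s ∧ r 1 = tree b := by
    rintro b (_ | c | t) hs
    · exact ⟨_, isPath_tree fun _ => b, rfl, rfl⟩
    · exact ⟨fun n => Nat.casesOn n (tree c) fun _ => tree b,
        by rintro (_ | n) <;> trivial, rfl, rfl⟩
    · exact absurd rfl (hs t)
  refine ⟨⟨_, isPath_tree fun _ => true, rfl, rfl⟩, fun r hr h₀ j hj => ?_,
    fun r hr h₀ hfbt => ?_, fun r hr h₀ hset r' hr' h₀' j => ?_⟩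
  · -- no trace of the model carries `fbt`, so `r j` is the root or one of the two bits
    have hne : ∀ t, r j ≠ trace t := by
      intro t ht
      change setNum .fbt ∈ (system (modelTraces F)).label (r j) at hj
      cases j with
      | zero => exact nomatch h₀.symm.trans ht
      | succ j =>
        rcases isPath_root hr h₀ with h | ⟨t', ht', h⟩
        · obtain ⟨b, hb⟩ := h j
          exact nomatch hb.symm.trans ht
        · rw [h j] at hj
          exact fbt_notMem_modelTraces F ht' _ hj
    obtain ⟨r₁, h₁, h₂, h₃⟩ := htree true (r j) hne
    obtain ⟨r₂, k₁, k₂, k₃⟩ := htree false (r j) hne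
    refine ⟨⟨r₁, h₁, h₂, ?_⟩, r₂, k₁, k₂, ?_⟩
    · simp [TransitionSystem.comap, h₃, system, setNum]
    · simp [TransitionSystem.comap, k₃, system, setNum]
  · rcases isPath_root hr h₀ with h | ⟨t, ht, h⟩
    · choose s hs using h
      refine ⟨_, isPath_trace (Or.inl ⟨{i | s i = true}, rfl⟩), h₀.symm, fun j => ?_⟩
      simp only [TransitionSystem.comap, hs, system, Set.mem_preimage, zero_add,
        bit1_mem_setTrace, bit0_mem_setTrace, pset_mem_setTrace, true_and]
      cases hj : s j <;> simp [setNum, hj]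
    · have := hfbt 0
      rw [h 0] at this
      exact absurd this (fbt_notMem_modelTraces F ht _)
  · rcases isPath_root hr h₀ with h | ⟨t, ht, h⟩
    · obtain ⟨b, hb⟩ := h 0
      rw [hb] at hset
      cases b <;> simp [TransitionSystem.comap, system, setNum] at hset
    · rw [h j, eq_trace_of_isPath hr' (h₀'.trans (h 0)) j]
      rfl

theorem opTraces_eq_traces : {t | t ∈ (fun t n => opNum ⁻¹' t n) ''
    (system.{u} (modelTraces F)).traces ∧ IsOpTrace t} = opTraces := by
  ext t
  constructor
  · rintro ⟨⟨t, ht, rfl⟩, hop⟩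
    rcases mem_traces_iff.1 ht with (⟨A, rfl⟩ | ⟨t, ht', rfl⟩) | ⟨s, rfl⟩
    · rcases hop with h | h <;> simp [setTrace, setNum, opNum, famNum] at h
    · simpa [Set.preimage_image_eq _ opNum_injective] using ht'
    · rcases hop with h | h <;> cases hs : s 0 <;> simp [system, setNum, opNum, hs] at h
  · intro ht
    refine ⟨⟨_, mem_traces_iff.2 (.inl (.inr ⟨t, ht, rfl⟩)), ?_⟩, ?_⟩
    · simp [Set.preimage_image_eq _ opNum_injective]
    · obtain ⟨b, a₁, a₂, rfl⟩ := mem_opTraces_iff.1 ht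
      exact isOpTrace_opTrace ..

theorem famOf_traces : famOf (system.{u} (modelTraces F)).traces = F := by
  funext X
  ext A
  constructor
  · rintro ⟨t, ht, hX, hA⟩
    rcases mem_traces_iff.1 ht with (⟨B, rfl⟩ | ⟨t, ht, rfl⟩) | ⟨s, rfl⟩
    · obtain rfl : B = A := Set.ext fun k => (bit1_mem_setTrace F B k).symm.trans (hA k)
      simpa [setTrace, setNum, famNum] using hX
    · obtain ⟨o, -, ho⟩ := hX
      cases o <;> simp [opNum, famNum] at ho
    · cases hs : s 0 <;> simp [system, setNum, famNum, hs] at hX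
  · intro hA
    refine ⟨setTrace F A, mem_traces_iff.2 (.inl (.inl ⟨A, rfl⟩)), ?_, bit1_mem_setTrace F A⟩
    exact Or.inr (Or.inr (Or.inr ⟨rfl, X, rfl, hA⟩))

theorem ctlModel_toSentence {ψ : ArithFormula} (hnum : ψ.freeNum = ∅) (hset : ψ.freeSet = ∅)
    (e : ℕ → ℕ) (E : ℕ → Set ℕ) (h : ψ.Holds e E F) :
    HyperFormula.CTLModel (system.{u} (modelTraces F)) ψ.toSentence := by
  rw [HyperFormula.ctlModel_toSentence_iff]
  refine ⟨ctlModel_setSentence F, setTrace F ∅, mem_traces_iff.2 (.inl (.inl ⟨∅, rfl⟩)),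
    opTraces_eq_traces F, ?_⟩
  rw [HyperFormula.ltlSat_toHyper (HyperFormula.isArithmetical_traces (ctlModel_setSentence F)
    (opTraces_eq_traces F)) ψ e E (by simp [hnum]) (by simp [hset]), famOf_traces]
  exact h

end ModelVertex

/-! ### Existential third-order arithmetic -/

/-- Truth depends only on the values of the free variables. -/
theorem ArithFormula.holds_congr (ψ : ArithFormula) {e e' : ℕ → ℕ} {E E' : ℕ → Set ℕ}
    {F F' : ℕ → Set (Set ℕ)} (he : ∀ x ∈ ψ.freeNum, e x = e' x)
    (hE : ∀ Y ∈ ψ.freeSet, E Y = E' Y) (hF : ∀ X ∈ ψ.freeFam, F X = F' X) :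
    ψ.Holds e E F ↔ ψ.Holds e' E' F' := by
  have hterm : ∀ (t : ArithTerm) {e e' : ℕ → ℕ}, (∀ x ∈ t.vars, e x = e' x) →
      t.eval e = t.eval e' := by
    intro t e e' h
    induction t with
    | zero => rfl
    | one => rfl
    | var x => exact h x rfl
    | add s t ihs iht =>
      rw [ArithTerm.eval, ArithTerm.eval, ihs fun x hx => h x (.inl hx),
        iht fun x hx => h x (.inr hx)]
    | mul s t ihs iht =>
      rw [ArithTerm.eval, ArithTerm.eval, ihs fun x hx => h x (.inl hx),
        iht fun x hx => h x (.inr hx)]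
  induction ψ generalizing e e' E E' with
  | eq s t =>
    rw [Holds, Holds, hterm s fun x hx => he x (.inl hx), hterm t fun x hx => he x (.inr hx)]
  | lt s t =>
    rw [Holds, Holds, hterm s fun x hx => he x (.inl hx), hterm t fun x hx => he x (.inr hx)]
  | memSet t Y => rw [Holds, Holds, hterm t he, hE Y rfl]
  | memFam Y X => rw [Holds, Holds, hE Y rfl, hF X rfl]
  | neg φ ih => exact not_congr (ih he hE hF)
  | or φ ψ ih₁ ih₂ =>
    exact or_congr
      (ih₁ (fun x hx => he x (.inl hx)) (fun x hx => hE x (.inl hx)) fun x hx => hF x (.inl hx))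
      (ih₂ (fun x hx => he x (.inr hx)) (fun x hx => hE x (.inr hx)) fun x hx => hF x (.inr hx))
  | exNum x φ ih =>
    refine exists_congr fun n => ih (fun y hy => ?_) hE hF
    by_cases hxy : y = x
    · simp [hxy]
    · simp [hxy, he y ⟨hy, hxy⟩]
  | exSet Z φ ih =>
    refine exists_congr fun A => ih he (fun Y hY => ?_) hF
    by_cases hYZ : Y = Z
    · simp [hYZ]
    · simp [hYZ, hE Y ⟨hY, hYZ⟩]

namespace ExThirdOrder

/-- Quantifying the third-order variables in `Xs` one by one amounts to choosing an
interpretation that differs from `F` only on `Xs`. -/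
theorem holdsAux_iff (ψ : ArithFormula) (e : ℕ → ℕ) (E : ℕ → Set ℕ) (Xs : List ℕ)
    (F : ℕ → Set (Set ℕ)) :
    HoldsAux ψ e E Xs F ↔ ∃ F', (∀ X ∉ Xs, F' X = F X) ∧ ψ.Holds e E F' := by
  induction Xs generalizing F with
  | nil =>
    refine ⟨fun h => ⟨F, fun _ _ => rfl, h⟩, fun ⟨F', hF', h⟩ => ?_⟩
    rwa [funext fun X => hF' X List.not_mem_nil] at h
  | cons X Xs ih =>
    simp only [HoldsAux, ih]
    constructor
    · rintro ⟨A, F', hF', h⟩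
      refine ⟨F', fun Y hY => ?_, h⟩
      rw [List.mem_cons, not_or] at hY
      rw [hF' Y hY.2, Function.update_of_ne hY.1]
    · rintro ⟨F', hF', h⟩
      refine ⟨F' X, F', fun Y hY => ?_, h⟩
      by_cases hYX : Y = X
      · simp [hYX]
      · rw [Function.update_of_ne hYX]
        exact hF' Y (by simp [hYX, hY])

theorem holds_iff {Φ : ExThirdOrder} {s : Set ℕ} (hΦ : Φ.FreeIn s) (e : ℕ → ℕ) :
    Φ.Holds e ↔ ∃ F, Φ.2.Holds e (fun _ => ∅) F := by
  rw [Holds, holdsAux_iff]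
  refine ⟨fun ⟨F, _, h⟩ => ⟨F, h⟩, fun ⟨F, h⟩ => ?_⟩
  classical
  refine ⟨fun X => if X ∈ Φ.1 then F X else ∅, fun X hX => by simp [hX], ?_⟩
  refine (ArithFormula.holds_congr _ (fun _ _ => rfl) (fun _ _ => rfl) fun X hX => ?_).1 h
  have : X ∈ Φ.1 := hΦ.2.2 hX
  simp [this]

/-- The translation of existential third-order arithmetic into HyperCTL*. The third-order
quantifiers are absorbed by the choice of a model. -/
def toSentence (Φ : ExThirdOrder) : HyperFormula ℕ := Φ.2.toSentence

variable {Φ : ExThirdOrder}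

theorem IsSentence.isCTLSentence (hΦ : Φ.IsSentence) : Φ.toSentence.IsCTLSentence :=
  HyperFormula.isCTLSentence_toSentence (Set.subset_empty_iff.1 hΦ.1) hΦ.2.1

theorem IsSentence.satisfiableTotal (hΦ : Φ.IsSentence) (h : Φ.IsTrue) :
    HyperFormula.CTLSatisfiableTotal.{u} Φ.toSentence := by
  obtain ⟨F, hF⟩ := (holds_iff hΦ _).1 h
  exact ⟨_, _, ModelVertex.isTotal_system,
    ModelVertex.ctlModel_toSentence F (Set.subset_empty_iff.1 hΦ.1) hΦ.2.1 _ _ hF⟩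

theorem IsSentence.isTrue (hΦ : Φ.IsSentence)
    (h : HyperFormula.CTLSatisfiable.{u} Φ.toSentence) : Φ.IsTrue := by
  obtain ⟨V, T, hT⟩ := h
  exact (holds_iff hΦ _).2 ⟨_, HyperFormula.holds_of_ctlModel (Set.subset_empty_iff.1 hΦ.1)
    hΦ.2.1 hT _ _⟩

theorem IsSentence.isTrue_iff (hΦ : Φ.IsSentence) :
    (Φ.IsTrue ↔ HyperFormula.CTLSatisfiable.{u} Φ.toSentence) ∧
      (Φ.IsTrue ↔ HyperFormula.CTLSatisfiableTotal.{u} Φ.toSentence) := by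
  have h : HyperFormula.CTLSatisfiableTotal.{u} Φ.toSentence →
      HyperFormula.CTLSatisfiable.{u} Φ.toSentence := fun ⟨V, T, _, h⟩ => ⟨V, T, h⟩
  exact ⟨⟨fun h' => h (hΦ.satisfiableTotal h'), hΦ.isTrue⟩,
    ⟨hΦ.satisfiableTotal, fun h' => hΦ.isTrue (h h')⟩⟩

end ExThirdOrder

/-! ### Computability of the translation -/

section Primrec

variable {α σ : Type} [Primcodable α] [Primcodable σ]

/-- Recursion along Gödel numbers: the value at `n ≠ 0` may be computed from `n` and from the
values at `(n - d) / k` and at the two components of this number as a pair. -/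
theorem primrec_of_subcodes {d k : ℕ} (hk : 2 ≤ k) {f : ℕ → σ} {g : ℕ → σ → σ → σ → σ}
    (hg : Primrec fun p : ℕ × σ × σ × σ => g p.1 p.2.1 p.2.2.1 p.2.2.2)
    (hf : ∀ n, n ≠ 0 → f n = g n (f ((n - d) / k)) (f ((n - d) / k).unpair.1)
      (f ((n - d) / k).unpair.2)) : Primrec f := by
  have hsub : Primrec fun n : ℕ => (n - d) / k :=
    Primrec.nat_div.comp (Primrec.nat_sub.comp .id (.const d)) (.const k)
  have hzero : PrimrecPred fun n : ℕ => n = 0 := Primrec.eq.comp .id (.const 0)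
  have hget : ∀ i, Primrec fun p : ℕ × List σ => p.2.getD i (f 0) := fun i =>
    (Primrec.list_getD (f 0)).comp .snd (.const i)
  -- `0` is its own subcode, so the value there enters as a constant
  refine Primrec.nat_omega_rec' f (m := id)
    (l := fun n => if n = 0 then [] else
      [(n - d) / k, ((n - d) / k).unpair.1, ((n - d) / k).unpair.2])
    (g := fun n v => some (if n = 0 then f 0 else
      g n (v.getD 0 (f 0)) (v.getD 1 (f 0)) (v.getD 2 (f 0))))
    .id ?_ ?_ ?_ ?_
  · refine Primrec.ite hzero (.const []) ?_
    exact Primrec.list_cons.comp hsub (Primrec.list_cons.comp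
      (Primrec.fst.comp (Primrec.unpair.comp hsub)) (Primrec.list_cons.comp
        (Primrec.snd.comp (Primrec.unpair.comp hsub)) (.const [])))
  · refine Primrec.option_some.comp (Primrec.ite (hzero.comp .fst) (.const _) ?_)
    exact hg.comp (Primrec.pair .fst (Primrec.pair (hget 0) (Primrec.pair (hget 1) (hget 2))))
  · intro n m hm
    have hlt : n ≠ 0 → (n - d) / k < n := fun hn =>
      (Nat.div_le_div_right (Nat.sub_le n d)).trans_lt
        (Nat.div_lt_self (Nat.pos_of_ne_zero hn) hk)
    by_cases hn : n = 0
    · simp [hn] at hm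
    · simp only [hn, if_false, List.mem_cons, List.not_mem_nil, or_false] at hm
      rcases hm with rfl | rfl | rfl
      · exact hlt hn
      · exact (Nat.unpair_left_le _).trans_lt (hlt hn)
      · exact (Nat.unpair_right_le _).trans_lt (hlt hn)
  · intro n
    by_cases hn : n = 0
    · simp [hn]
    · simp [hn, hf n hn]

theorem primrec_mul_add {f : α → ℕ} (hf : Primrec f) (k c : ℕ) :
    Primrec fun a => k * f a + c :=
  Primrec.nat_add.comp (Primrec.nat_mul.comp (.const k) hf) (.const c)

namespace HyperFormula

variable {p q r : α → ℕ} {f g : α → HyperFormula ℕ}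

theorem primrec_atom {a : α → ℕ} (ha : Primrec a) (hp : Primrec p) :
    Primrec fun x => atom (a x) (p x) :=
  Primrec.encode_iff.1 (primrec_mul_add (Primrec₂.natPair.comp ha hp) 7 0)

theorem primrec_neg (hf : Primrec f) : Primrec fun a => neg (f a) :=
  Primrec.encode_iff.1 (primrec_mul_add (Primrec.encode.comp hf) 7 1)

theorem primrec_or (hf : Primrec f) (hg : Primrec g) : Primrec fun a => or (f a) (g a) :=
  Primrec.encode_iff.1 (primrec_mul_add
    (Primrec₂.natPair.comp (Primrec.encode.comp hf) (Primrec.encode.comp hg)) 7 2)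

theorem primrec_next (hf : Primrec f) : Primrec fun a => next (f a) :=
  Primrec.encode_iff.1 (primrec_mul_add (Primrec.encode.comp hf) 7 3)

theorem primrec_untl (hf : Primrec f) (hg : Primrec g) : Primrec fun a => untl (f a) (g a) :=
  Primrec.encode_iff.1 (primrec_mul_add
    (Primrec₂.natPair.comp (Primrec.encode.comp hf) (Primrec.encode.comp hg)) 7 4)

theorem primrec_ex (hp : Primrec p) (hf : Primrec f) : Primrec fun a => ex (p a) (f a) :=
  Primrec.encode_iff.1 (primrec_mul_add (Primrec₂.natPair.comp hp (Primrec.encode.comp hf)) 7 5)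

theorem primrec_all (hp : Primrec p) (hf : Primrec f) : Primrec fun a => all (p a) (f a) :=
  Primrec.encode_iff.1 (primrec_mul_add (Primrec₂.natPair.comp hp (Primrec.encode.comp hf)) 7 6)

theorem primrec_conj (hf : Primrec f) (hg : Primrec g) : Primrec fun a => conj (f a) (g a) :=
  primrec_neg (primrec_or (primrec_neg hf) (primrec_neg hg))

theorem primrec_impl (hf : Primrec f) (hg : Primrec g) : Primrec fun a => impl (f a) (g a) :=
  primrec_or (primrec_neg hf) hg

theorem primrec_equiv (hf : Primrec f) (hg : Primrec g) : Primrec fun a => equiv (f a) (g a) :=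
  primrec_conj (primrec_impl hf hg) (primrec_impl hg hf)

theorem primrec_eventually (hf : Primrec f) : Primrec fun a => eventually (f a) :=
  primrec_untl (primrec_or hf (primrec_neg hf)) hf

theorem primrec_always (hf : Primrec f) : Primrec fun a => always (f a) :=
  primrec_neg (primrec_eventually (primrec_neg hf))

theorem primrec_once (c : ℕ) (hp : Primrec p) : Primrec fun a => once c (p a) :=
  have h := primrec_atom (.const c) hp
  primrec_untl (primrec_neg h) (primrec_conj h (primrec_next (primrec_always (primrec_neg h))))

theorem primrec_meet (c d : ℕ) (hp : Primrec p) (hq : Primrec q) :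
    Primrec fun a => meet c (p a) d (q a) :=
  primrec_eventually (primrec_conj (primrec_atom (.const c) hp) (primrec_atom (.const d) hq))

theorem primrec_opRel (o : OpProp) (hp : Primrec p) (hq : Primrec q) (hr : Primrec r) :
    Primrec fun a => opRel o (p a) (q a) (r a) :=
  primrec_ex (.const 0) (primrec_conj (.const _) (primrec_conj (primrec_meet _ _ (.const 0) hp)
    (primrec_conj (primrec_meet _ _ (.const 0) hq) (primrec_meet _ _ (.const 0) hr))))

theorem primrec_bindNum (hp : Primrec p) (hf : Primrec f) (hg : Primrec g) :
    Primrec fun a => bindNum (p a) (f a) (g a) :=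
  primrec_ex hp (primrec_conj (primrec_once _ hp) (primrec_conj hf hg))

end HyperFormula

theorem primrec_numVar {f : α → ℕ} (hf : Primrec f) : Primrec fun a => numVar (f a) :=
  primrec_mul_add hf 3 1

theorem primrec_setVar {f : α → ℕ} (hf : Primrec f) : Primrec fun a => setVar (f a) :=
  primrec_mul_add hf 3 2

theorem primrec_resVar {f : α → ℕ} (hf : Primrec f) : Primrec fun a => resVar (f a) :=
  primrec_mul_add hf 3 3

theorem ArithTerm.ofNat_code (t : ArithTerm) : Denumerable.ofNat ArithTerm t.code = t :=
  Denumerable.ofNat_encode t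

theorem ArithFormula.ofNat_code (φ : ArithFormula) :
    Denumerable.ofNat ArithFormula φ.code = φ :=
  Denumerable.ofNat_encode φ

open HyperFormula in
theorem ArithTerm.primrec_isValue : Primrec ArithTerm.isValue := by
  refine Primrec.ofNat_iff.2 (primrec_of_subcodes (d := 2) (k := 3) (by norm_num)
    (g := fun n _ φ ψ =>
      if n = 1 then next (atom bit (resVar 1))
      else if (n - 2) % 3 = 0 then meet bit (numVar ((n - 2) / 3)) bit (resVar n)
      else if (n - 2) % 3 = 1 then
        bindNum (resVar ((n - 2) / 3).unpair.1) φ (bindNum (resVar ((n - 2) / 3).unpair.2) ψ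
          (opRel .add (resVar ((n - 2) / 3).unpair.1) (resVar ((n - 2) / 3).unpair.2) (resVar n)))
      else
        bindNum (resVar ((n - 2) / 3).unpair.1) φ (bindNum (resVar ((n - 2) / 3).unpair.2) ψ
          (opRel .mult (resVar ((n - 2) / 3).unpair.1) (resVar ((n - 2) / 3).unpair.2)
            (resVar n)))) ?_ ?_)
  · let β := ℕ × HyperFormula ℕ × HyperFormula ℕ × HyperFormula ℕ
    have hn : Primrec fun p : β => p.1 := .fst
    have hφ : Primrec fun p : β => p.2.2.1 := Primrec.fst.comp (Primrec.snd.comp .snd)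
    have hψ : Primrec fun p : β => p.2.2.2 := Primrec.snd.comp (Primrec.snd.comp .snd)
    have hsub : Primrec fun p : β => p.1 - 2 := Primrec.nat_sub.comp hn (.const 2)
    have hdiv : Primrec fun p : β => (p.1 - 2) / 3 := Primrec.nat_div.comp hsub (.const 3)
    have hmod : ∀ i, PrimrecPred fun p : β => (p.1 - 2) % 3 = i := fun i =>
      Primrec.eq.comp (Primrec.nat_mod.comp hsub (.const 3)) (.const i)
    have hl : Primrec fun p : β => resVar ((p.1 - 2) / 3).unpair.1 :=
      primrec_resVar (Primrec.fst.comp (Primrec.unpair.comp hdiv))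
    have hr : Primrec fun p : β => resVar ((p.1 - 2) / 3).unpair.2 :=
      primrec_resVar (Primrec.snd.comp (Primrec.unpair.comp hdiv))
    have hop : ∀ o, Primrec fun p : β =>
        bindNum (resVar ((p.1 - 2) / 3).unpair.1) p.2.2.1
          (bindNum (resVar ((p.1 - 2) / 3).unpair.2) p.2.2.2
            (opRel o (resVar ((p.1 - 2) / 3).unpair.1) (resVar ((p.1 - 2) / 3).unpair.2)
              (resVar p.1))) := fun o =>
      primrec_bindNum hl hφ (primrec_bindNum hr hψ (primrec_opRel o hl hr (primrec_resVar hn)))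
    exact Primrec.ite (Primrec.eq.comp hn (.const 1)) (.const _)
      (Primrec.ite (hmod 0) (primrec_meet _ _ (primrec_numVar hdiv) (primrec_resVar hn))
        (Primrec.ite (hmod 1) (hop .add) (hop .mult)))
  · intro n hn
    obtain ⟨t, rfl⟩ := ArithTerm.code_surjective n
    rw [ofNat_code]
    cases t with
    | zero => exact absurd rfl hn
    | one => rfl
    | var x =>
      have h₁ : 3 * x + 2 ≠ 1 := by omega
      simp [isValue, code, h₁]
    | add s t =>
      have h₁ : 3 * Nat.pair s.code t.code + 3 - 2 = 3 * Nat.pair s.code t.code + 1 := by omega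
      have h₂ : (3 * Nat.pair s.code t.code + 1) / 3 = Nat.pair s.code t.code := by omega
      simp [isValue, code, h₁, h₂, ofNat_code, Nat.add_mod]
    | mul s t =>
      have h₁ : 3 * Nat.pair s.code t.code + 4 - 2 = 3 * Nat.pair s.code t.code + 2 := by omega
      have h₂ : (3 * Nat.pair s.code t.code + 2) / 3 = Nat.pair s.code t.code := by omega
      simp [isValue, code, h₁, h₂, ofNat_code, Nat.add_mod]

open HyperFormula in
theorem ArithTerm.primrec_bindValue {c : α → ℕ} {f : α → HyperFormula ℕ} (hc : Primrec c)
    (hf : Primrec f) :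
    Primrec fun a => (Denumerable.ofNat ArithTerm (c a)).bindValue (f a) := by
  have : Primrec fun a => bindNum (resVar (c a)) (Denumerable.ofNat ArithTerm (c a)).isValue
      (f a) :=
    primrec_bindNum (primrec_resVar hc)
      (ArithTerm.primrec_isValue.comp ((Primrec.ofNat ArithTerm).comp hc)) hf
  refine this.of_eq fun a => ?_
  obtain ⟨t, ht⟩ := ArithTerm.code_surjective (c a)
  rw [ArithTerm.bindValue, ← ht, ofNat_code]

open HyperFormula in
theorem ArithFormula.primrec_toHyper : Primrec ArithFormula.toHyper := by
  refine Primrec.ofNat_iff.2 (primrec_of_subcodes (d := 0) (k := 8) (by norm_num)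
    (g := fun n χ φ ψ =>
      if n % 8 = 0 then
        (Denumerable.ofNat ArithTerm (n / 8).unpair.1).bindValue
          ((Denumerable.ofNat ArithTerm (n / 8).unpair.2).bindValue
            (meet bit (resVar (n / 8).unpair.1) bit (resVar (n / 8).unpair.2)))
      else if n % 8 = 1 then
        (Denumerable.ofNat ArithTerm (n / 8).unpair.1).bindValue
          ((Denumerable.ofNat ArithTerm (n / 8).unpair.2).bindValue
            (eventually (conj (atom bit (resVar (n / 8).unpair.1))
              (next (eventually (atom bit (resVar (n / 8).unpair.2)))))))
      else if n % 8 = 2 then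
        (Denumerable.ofNat ArithTerm (n / 8).unpair.1).bindValue
          (meet bit (resVar (n / 8).unpair.1) bit (setVar (n / 8).unpair.2))
      else if n % 8 = 3 then
        ex 0 (conj (atom (famNum (n / 8).unpair.2) 0)
          (always (equiv (atom bit 0) (atom bit (setVar (n / 8).unpair.1)))))
      else if n % 8 = 4 then .neg χ
      else if n % 8 = 5 then .or φ ψ
      else if n % 8 = 6 then
        ex (numVar (n / 8).unpair.1) (conj (once bit (numVar (n / 8).unpair.1)) ψ)
      else ex (setVar (n / 8).unpair.1) ψ) ?_ ?_)
  · let β := ℕ × HyperFormula ℕ × HyperFormula ℕ × HyperFormula ℕ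
    have hn : Primrec fun p : β => p.1 := .fst
    have hχ : Primrec fun p : β => p.2.1 := Primrec.fst.comp .snd
    have hφ : Primrec fun p : β => p.2.2.1 := Primrec.fst.comp (Primrec.snd.comp .snd)
    have hψ : Primrec fun p : β => p.2.2.2 := Primrec.snd.comp (Primrec.snd.comp .snd)
    have hdiv : Primrec fun p : β => p.1 / 8 :=
      Primrec.nat_div.comp hn (.const 8)
    have hmod : ∀ i, PrimrecPred fun p : β => p.1 % 8 = i := fun i =>
      Primrec.eq.comp (Primrec.nat_mod.comp hn (.const 8)) (.const i)
    have hl : Primrec fun p : β => (p.1 / 8).unpair.1 :=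
      Primrec.fst.comp (Primrec.unpair.comp hdiv)
    have hr : Primrec fun p : β => (p.1 / 8).unpair.2 :=
      Primrec.snd.comp (Primrec.unpair.comp hdiv)
    have hb : ∀ {f : β → ℕ}, Primrec f → Primrec fun p => atom bit (f p) := fun hf =>
      primrec_atom (.const _) hf
    refine Primrec.ite (hmod 0) ?_ (Primrec.ite (hmod 1) ?_ (Primrec.ite (hmod 2) ?_
      (Primrec.ite (hmod 3) ?_ (Primrec.ite (hmod 4) (primrec_neg hχ) (Primrec.ite (hmod 5)
        (primrec_or hφ hψ) (Primrec.ite (hmod 6) ?_ (primrec_ex (primrec_setVar hl) hψ)))))))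
    · exact ArithTerm.primrec_bindValue hl (ArithTerm.primrec_bindValue hr
        (primrec_meet _ _ (primrec_resVar hl) (primrec_resVar hr)))
    · exact ArithTerm.primrec_bindValue hl (ArithTerm.primrec_bindValue hr
        (primrec_eventually (primrec_conj (hb (primrec_resVar hl))
          (primrec_next (primrec_eventually (hb (primrec_resVar hr)))))))
    · exact ArithTerm.primrec_bindValue hl
        (primrec_meet _ _ (primrec_resVar hl) (primrec_setVar hr))
    · exact primrec_ex (.const 0) (primrec_conj
        (primrec_atom (Primrec.nat_add.comp hr (.const 9)) (.const 0))
        (primrec_always (primrec_equiv (.const _) (hb (primrec_setVar hl)))))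
    · exact primrec_ex (primrec_numVar hl)
        (primrec_conj (primrec_once _ (primrec_numVar hl)) hψ)
  · intro n _
    obtain ⟨φ, rfl⟩ := ArithFormula.code_surjective n
    have hdiv : ∀ m i, i < 8 → (8 * m + i) / 8 = m := fun m i hi => by omega
    rw [ofNat_code]
    cases φ <;>
      simp [toHyper, code, hdiv, ofNat_code, ArithTerm.ofNat_code, Nat.add_mod]

theorem HyperFormula.ofNat_code (φ : HyperFormula ℕ) :
    Denumerable.ofNat (HyperFormula ℕ) φ.code = φ :=
  Denumerable.ofNat_encode φ

open HyperFormula in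
theorem HyperFormula.primrec_delay : Primrec (delay : HyperFormula ℕ → HyperFormula ℕ) := by
  refine Primrec.ofNat_iff.2 (primrec_of_subcodes (d := 0) (k := 7) (by norm_num)
    (g := fun n χ φ ψ =>
      if n % 7 = 1 then neg χ
      else if n % 7 = 2 then or φ ψ
      else if n % 7 = 5 then ex (n / 7).unpair.1 ψ
      else if n % 7 = 6 then all (n / 7).unpair.1 ψ
      else next (Denumerable.ofNat (HyperFormula ℕ) n)) ?_ ?_)
  · let β := ℕ × HyperFormula ℕ × HyperFormula ℕ × HyperFormula ℕ
    have hn : Primrec fun p : β => p.1 := .fst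
    have hχ : Primrec fun p : β => p.2.1 := Primrec.fst.comp .snd
    have hφ : Primrec fun p : β => p.2.2.1 := Primrec.fst.comp (Primrec.snd.comp .snd)
    have hψ : Primrec fun p : β => p.2.2.2 := Primrec.snd.comp (Primrec.snd.comp .snd)
    have hmod : ∀ i, PrimrecPred fun p : β => p.1 % 7 = i := fun i =>
      Primrec.eq.comp (Primrec.nat_mod.comp hn (.const 7)) (.const i)
    have hl : Primrec fun p : β => (p.1 / 7).unpair.1 :=
      Primrec.fst.comp (Primrec.unpair.comp
        (Primrec.nat_div.comp hn (.const 7)))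
    exact Primrec.ite (hmod 1) (primrec_neg hχ) (Primrec.ite (hmod 2) (primrec_or hφ hψ)
      (Primrec.ite (hmod 5) (primrec_ex hl hψ) (Primrec.ite (hmod 6) (primrec_all hl hψ)
        (primrec_next ((Primrec.ofNat _).comp hn)))))
  · intro n _
    obtain ⟨φ, rfl⟩ := HyperFormula.code_surjective n
    have hdiv : ∀ m i, i < 7 → (7 * m + i) / 7 = m := fun m i hi => by omega
    rw [ofNat_code]
    cases φ <;> simp [delay, code, hdiv, ofNat_code, Nat.add_mod]

open HyperFormula in
theorem ExThirdOrder.computable_toSentence : Computable ExThirdOrder.toSentence := by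
  have : Primrec fun Φ : ExThirdOrder => Φ.2.toHyper := ArithFormula.primrec_toHyper.comp .snd
  exact (primrec_conj (.const _) (primrec_delay.comp
    (primrec_ex (.const 0) (primrec_conj (.const _) this)))).to_comp

/-! ### Hardness -/

/-- The numeral of `n`. -/
def ArithTerm.numeral : ℕ → ArithTerm
  | 0 => .zero
  | n + 1 => .add (numeral n) .one

theorem ArithTerm.eval_numeral (e : ℕ → ℕ) (n : ℕ) : (numeral n).eval e = n := by
  induction n with
  | zero => rfl
  | succ n ih => rw [numeral, eval, ih]; rfl

theorem ArithTerm.vars_numeral (n : ℕ) : (numeral n).vars = ∅ := by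
  induction n with
  | zero => rfl
  | succ n ih => rw [numeral, vars, ih]; exact Set.union_self ∅

theorem ArithTerm.primrec_numeral : Primrec numeral := by
  have : Primrec fun n => (numeral n).code := by
    refine (Primrec.nat_rec₁ (f := fun _ c => 3 * Nat.pair c 1 + 3) 0 ?_).of_eq fun n => ?_
    · exact (primrec_mul_add (Primrec₂.natPair.comp .snd (.const 1)) 3 3).to₂
    · induction n with
      | zero => rfl
      | succ n ih => simp only [numeral, code, ← ih]
  exact Primrec.encode_iff.1 this

/-- The result of substituting the numeral of `n` for the number variable `0`, written as
`∃ x₀. ¬(¬ x₀ = n ∨ ¬ψ)` under the third-order quantifiers. -/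
def ExThirdOrder.substNumeral (Φ : ExThirdOrder) (n : ℕ) : ExThirdOrder :=
  (Φ.1, .exNum 0 (.neg (.or (.neg (.eq (.var 0) (ArithTerm.numeral n))) (.neg Φ.2))))

namespace ExThirdOrder

variable {Φ : ExThirdOrder}

theorem FreeIn.isSentence_substNumeral (hΦ : Φ.FreeIn {0}) (n : ℕ) :
    (Φ.substNumeral n).IsSentence := by
  refine ⟨?_, ?_, ?_⟩
  · simp only [substNumeral, ArithFormula.freeNum, ArithTerm.vars, ArithTerm.vars_numeral]
    rintro x ⟨(rfl | h) | h, hx⟩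
    · exact hx rfl
    · exact h
    · exact hx (hΦ.1 h)
  · simpa [substNumeral, ArithFormula.freeSet] using hΦ.2.1
  · simpa [substNumeral, ArithFormula.freeFam] using hΦ.2.2

theorem FreeIn.isTrue_substNumeral_iff (hΦ : Φ.FreeIn {0}) (n : ℕ) :
    (Φ.substNumeral n).IsTrue ↔ Φ.Holds (fun _ => n) := by
  rw [IsTrue, holds_iff (hΦ.isSentence_substNumeral n), holds_iff hΦ]
  refine exists_congr fun F => ?_
  have hcongr : Φ.2.Holds (Function.update (fun _ => 0) 0 n) (fun _ => ∅) F ↔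
      Φ.2.Holds (fun _ => n) (fun _ => ∅) F := by
    refine ArithFormula.holds_congr _ (fun x hx => ?_) (fun _ _ => rfl) fun _ _ => rfl
    obtain rfl : x = 0 := hΦ.1 hx
    simp
  simp [substNumeral, ArithFormula.Holds, ArithTerm.eval, ArithTerm.eval_numeral, hcongr]

theorem computable_substNumeral (Φ : ExThirdOrder) : Computable Φ.substNumeral := by
  have h : Primrec fun n => (ArithTerm.numeral n).code :=
    Primrec.encode.comp ArithTerm.primrec_numeral
  have : Primrec fun n => (Φ.substNumeral n).2.code :=
    primrec_mul_add (Primrec₂.natPair.comp (.const 0) (primrec_mul_add (primrec_mul_add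
      (Primrec₂.natPair.comp (primrec_mul_add (primrec_mul_add
        (Primrec₂.natPair.comp (.const (ArithTerm.var 0).code) h) 8 0) 8 4)
          (.const (ArithFormula.neg Φ.2).code)) 8 5) 8 4)) 8 6
  exact (Primrec.pair (.const Φ.1) (Primrec.encode_iff.1 this)).to_comp

/-- Any computable translation of sentences that reduces truth to membership in `P` witnesses
`Σ²₁`-hardness. -/
theorem isSigmaTwoOneHard {I P : Set (HyperFormula ℕ)}
    (h : ∀ Φ : ExThirdOrder, Φ.IsSentence → Φ.toSentence ∈ I ∧ (Φ.IsTrue ↔ Φ.toSentence ∈ P)) :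
    IsSigmaTwoOneHard I P := by
  rintro N ⟨Φ, hΦ, hN⟩
  refine ⟨fun n => (Φ.substNumeral n).toSentence,
    computable_toSentence.comp (computable_substNumeral Φ), fun n => ?_⟩
  obtain ⟨h₁, h₂⟩ := h _ (hΦ.isSentence_substNumeral n)
  exact ⟨h₁, by rw [hN, ← hΦ.isTrue_substNumeral_iff, h₂]⟩

end ExThirdOrder

end Primrec

theorem mainTheorem2 :
    -- satisfiability of HyperCTL* sentences is hard, over arbitrary and over total systems
    IsSigmaTwoOneHard
      {φ : HyperFormula ℕ | φ.IsCTLSentence}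
      {φ : HyperFormula ℕ | HyperFormula.CTLSatisfiable.{u} φ} ∧
    IsSigmaTwoOneHard
      {φ : HyperFormula ℕ | φ.IsCTLSentence}
      {φ : HyperFormula ℕ | HyperFormula.CTLSatisfiableTotal.{u} φ} ∧
    -- the computable translation of existential third-order arithmetic
    (∃ tr : ExThirdOrder → HyperFormula ℕ, Computable tr ∧
      ∀ Φ : ExThirdOrder, Φ.IsSentence →
        (tr Φ).IsCTLSentence ∧
        (Φ.IsTrue ↔ HyperFormula.CTLSatisfiable.{u} (tr Φ)) ∧
        (Φ.IsTrue ↔ HyperFormula.CTLSatisfiableTotal.{u} (tr Φ))) ∧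
    -- a satisfiable sentence that forces every subset of ℕ to appear as a path
    (∃ φset : HyperFormula SetProp, φset.IsCTLSentence ∧
      HyperFormula.CTLSatisfiableTotal.{u} φset ∧
      ∀ (V : Type u) (T : TransitionSystem SetProp V), HyperFormula.CTLModel T φset →
        RepresentsAllSets T ∧ Cardinal.continuum.{u} ≤ Cardinal.mk V) ∧
    -- a HyperLTL sentence that defines addition and multiplication
    (∃ φop : HyperFormula OpProp, φop.IsLTLSentence ∧
      ∀ S : Set (ℕ → Set OpProp), HyperFormula.LTLModel S φop ↔ S = opTraces) := by
  refine ⟨ExThirdOrder.isSigmaTwoOneHard fun Φ hΦ => ⟨hΦ.isCTLSentence, hΦ.isTrue_iff.1⟩,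
    ExThirdOrder.isSigmaTwoOneHard fun Φ hΦ => ⟨hΦ.isCTLSentence, hΦ.isTrue_iff.2⟩,
    ⟨ExThirdOrder.toSentence, ExThirdOrder.computable_toSentence, fun Φ hΦ =>
      ⟨hΦ.isCTLSentence, hΦ.isTrue_iff⟩⟩,
    ⟨HyperFormula.setSentence, HyperFormula.isCTLSentence_setSentence,
      ⟨_, _, ?_, ModelVertex.ctlModel_setSentence fun _ => ∅⟩, fun V T hT => ?_⟩,
    ⟨HyperFormula.opOnlySentence, HyperFormula.isLTLSentence_opOnlySentence, fun S =>
      HyperFormula.ltlModel_opOnlySentence_iff S⟩⟩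
  · exact ModelVertex.isTotal_system (S := ModelVertex.modelTraces fun _ => ∅)
  · exact ⟨HyperFormula.representsAllSets_of_ctlModel hT,
      (HyperFormula.representsAllSets_of_ctlModel hT).continuum_le⟩
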